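/- Let $E$ be a second countable locally compact Hausdorff groupoid with unit space $E^{(0)}$, range and source maps $r,s$ and a Haar system. Assume that $E$ is principal ($s(\gamma)=r(\gamma)$ implies that $\gamma$ is a unit) and proper ($\{\gamma\in E: s(\gamma)\in K,\ r(\gamma)\in L\}$ is compact for all compact $K,L\subset E^{(0)}$). Let $\mathscr A$ be an upper semicontinuous $C^*$-bundle over $E^{(0)}$ with fibres $A(u)$, whose section algebra $A=\Gamma_0(E^{(0)},\mathscr A)$ is separable, and let $\alpha=(\alpha_\gamma)_{\gamma\in E}$ be a continuous action of $E$ on $\mathscr A$ by $*$-isomorphisms $\alpha_\gamma:A(s(\gamma))\to A(r(\gamma))$ with $\alpha_\gamma\alpha_\eta=\alpha_{\gamma\eta}$ for composable $\gamma,\eta$. Let $\operatorname{Ind}(A,\alpha)$ be the $C^*$-algebra of all bounded continuous sections $f$ of $\mathscr A$ such that $f(r(\gamma))=\alpha_\gamma(f(s(\gamma)))$ for all $\gamma\in E$ and such that $E\cdot u\mapsto\|f(u)\|$ vanishes at infinity on $E\backslash E^{(0)}$. Write $\varepsilon_u$ for the evaluation $f\mapsto f(u)$ of sections at $u$, and let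 the spectrum $\widehat B$ of a $C^*$-algebra $B$ be the set of unitary equivalence classes of irreducible representations of $B$ with the hull-kernel topology. Then every irreducible representation $\pi$ of $A$ can be written as $\pi=\pi_u\circ\varepsilon_u$ for a unique $u\in E^{(0)}$ and a unique representation $\pi_u$ of $A(u)$ on $\mathcal H_\pi$. For $\gamma\in E$ with $s(\gamma)=u$, the representation $\gamma\cdot\pi=\pi_{u}\circ\alpha_\gamma^{-1}\circ\varepsilon_{r(\gamma)}$ of $A$ is again irreducible, and the relation on $\widehat A$ that relates $[\pi]$ to $[\gamma\cdot\pi]$ for all such $\pi$ and $\gamma$ is an equivalence relation; let $E\backslash\widehat A$ be the space of its classes (the orbits), with the quotient topology. For every irreducible representation $\pi=\pi_u\circ\varepsilon_u$ of $A$, the map $$M(\pi)=\pi_u\circ\varepsilon_u:\operatorname{Ind}(A,\alpha)\to B(\mathcal H_\pi)$$ is an irreducible representation of $\operatorname{Ind}(A,\alpha)$, and $M$ induces a homeomorphism $E\cdot[\pi]\mapsto[M(\pi)]$ of $E\backslash\widehat A$ onto $\operatorname{Ind}(A,\alpha)^{\wedge}$. -/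

import Mathlib

open Filter Topology MeasureTheory CategoryTheory
open scoped ENNReal

universe u v w t

noncomputable section

namespace IndAlg

/-! ## Upper semicontinuous `C*`-bundles -/

section Vanishing

variable {X : Type u} (A : X → Type w) [∀ x, NonUnitalCStarAlgebra (A x)]

/-- The bounded sections whose norm tends to `0` along the filter `l`. -/
def sectionsVanishing (l : Filter X) : NonUnitalStarSubalgebra ℂ (lp A ∞) where
  carrier := {f | Tendsto (fun x => ‖f x‖) l (𝓝 0)}
  add_mem' {f g} hf hg := by
    refine squeeze_zero (fun _ => norm_nonneg _) (fun x => norm_add_le (f x) (g x)) ?_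
    simpa using Tendsto.add hf hg
  zero_mem' := by
    refine tendsto_const_nhds.congr fun x => ?_
    exact norm_zero.symm
  mul_mem' {f g} hf hg := by
    refine squeeze_zero (fun _ => norm_nonneg _) (fun x => norm_mul_le (f x) (g x)) ?_
    simpa using Tendsto.mul hf hg
  smul_mem' c f hf := by
    refine squeeze_zero (fun _ => norm_nonneg _) (fun x => (norm_smul c (f x)).le) ?_
    simpa using Tendsto.const_mul ‖c‖ hf
  star_mem' {f} hf := by
    refine Tendsto.congr (fun x => ?_) hf
    exact (norm_star (f x)).symm

lemma isClosed_sectionsVanishing (l : Filter X) :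
    IsClosed (sectionsVanishing A l : Set (lp A ∞)) := by
  refine isClosed_of_closure_subset fun f hf => ?_
  change Tendsto (fun x => ‖f x‖) l (𝓝 0)
  refine tendsto_order.2 ⟨fun a ha => Eventually.of_forall fun x => ha.trans_le (norm_nonneg _),
    fun ε hε => ?_⟩
  obtain ⟨g, hg, hfg⟩ := Metric.mem_closure_iff.1 hf (ε / 2) (half_pos hε)
  have hg' : ∀ᶠ x in l, ‖g x‖ < ε / 2 :=
    (show Tendsto (fun x => ‖g x‖) l (𝓝 0) from hg).eventually_lt_const (half_pos hε)
  filter_upwards [hg'] with x hx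
  have h1 : ‖f x - g x‖ < ε / 2 := by
    have := lp.norm_apply_le_norm ENNReal.top_ne_zero (f - g) x
    rw [dist_eq_norm] at hfg
    exact lt_of_le_of_lt this hfg
  calc ‖f x‖ = ‖(f x - g x) + g x‖ := by simp
    _ ≤ ‖f x - g x‖ + ‖g x‖ := norm_add_le _ _
    _ < ε := by linarith

end Vanishing

section Bundle

variable {X : Type u}

/-- The total space `𝒜 = ⨆ₓ A(x)` of a family of fibres over `X`. (The first argument of
`Bundle.TotalSpace` is a phantom and plays no role.) It carries no topology by default; the
topology of a bundle is an instance argument. -/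
abbrev Tot (A : X → Type w) : Type (max u w) := Bundle.TotalSpace PUnit.{1} A

/-- The fibred product `𝒜 * 𝒜` of the total space with itself over `X`. -/
structure FibrePair (A : X → Type w) where
  base : X
  fst : A base
  snd : A base

/-- `𝒜 * 𝒜` carries the relative topology of `𝒜 × 𝒜`. -/
instance (A : X → Type w) [TopologicalSpace (Tot A)] : TopologicalSpace (FibrePair A) :=
  TopologicalSpace.induced
    (fun p => ((⟨p.base, p.fst⟩ : Tot A), (⟨p.base, p.snd⟩ : Tot A))) inferInstance

/-- The total space of the family of `C*`-algebras `A`, with its given topology, is an upper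
semicontinuous `C*`-bundle over `X`. The axiom `tendsto_zero` says: if a net `zᵢ` in the total
space satisfies `‖zᵢ‖ → 0` and `p(zᵢ) → x`, then `zᵢ → 0ₓ`. -/
class IsUSCCStarBundle [TopologicalSpace X] (A : X → Type w) [∀ x, NonUnitalCStarAlgebra (A x)]
    [TopologicalSpace (Tot A)] : Prop where
  continuous_proj : Continuous (fun z : Tot A => z.proj)
  isOpenMap_proj : IsOpenMap (fun z : Tot A => z.proj)
  usc_norm : UpperSemicontinuous (fun z : Tot A => ‖z.snd‖)
  continuous_add : Continuous (fun p : FibrePair A => (⟨p.base, p.fst + p.snd⟩ : Tot A))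
  continuous_smul : ∀ c : ℂ, Continuous (fun z : Tot A => (⟨z.proj, c • z.snd⟩ : Tot A))
  tendsto_zero : ∀ x : X,
    comap (fun z : Tot A => ‖z.snd‖) (𝓝 0) ⊓ comap (fun z : Tot A => z.proj) (𝓝 x) ≤
      𝓝 (⟨x, 0⟩ : Tot A)
  continuous_mul : Continuous (fun p : FibrePair A => (⟨p.base, p.fst * p.snd⟩ : Tot A))
  continuous_star : Continuous (fun z : Tot A => (⟨z.proj, star z.snd⟩ : Tot A))

variable [TopologicalSpace X] (A : X → Type w) [∀ x, NonUnitalCStarAlgebra (A x)]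
  [TopologicalSpace (Tot A)]

/-- The `C*`-algebra `Γᵇ(X, 𝒜)` of bounded continuous sections, with pointwise operations and the
supremum norm, inside the `C*`-algebra `lp A ∞` of all bounded (not necessarily continuous)
sections. -/
def boundedSections [IsUSCCStarBundle A] : NonUnitalStarSubalgebra ℂ (lp A ∞) where
  carrier := {f | Continuous (fun x => (⟨x, f x⟩ : Tot A))}
  add_mem' {f g} hf hg := (IsUSCCStarBundle.continuous_add (A := A)).comp
    (g := fun p : FibrePair A => (⟨p.base, p.fst + p.snd⟩ : Tot A))
    (f := fun x => (⟨x, f x, g x⟩ : FibrePair A))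
    (continuous_induced_rng.2 (hf.prodMk hg))
  zero_mem' := by
    refine continuous_iff_continuousAt.2 fun x => ?_
    refine Tendsto.mono_right ?_ (IsUSCCStarBundle.tendsto_zero (A := A) x)
    refine tendsto_inf.2 ⟨tendsto_comap_iff.2 ?_, tendsto_comap_iff.2 tendsto_id⟩
    have : ((fun z : Tot A => ‖z.snd‖) ∘ fun y => (⟨y, (0 : lp A ∞) y⟩ : Tot A)) =
        fun _ => (0 : ℝ) := by
      funext y
      exact norm_zero
    rw [this]
    exact tendsto_const_nhds
  mul_mem' {f g} hf hg := (IsUSCCStarBundle.continuous_mul (A := A)).comp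
    (g := fun p : FibrePair A => (⟨p.base, p.fst * p.snd⟩ : Tot A))
    (f := fun x => (⟨x, f x, g x⟩ : FibrePair A))
    (continuous_induced_rng.2 (hf.prodMk hg))
  smul_mem' c f hf := (IsUSCCStarBundle.continuous_smul (A := A) c).comp hf
  star_mem' {f} hf := (IsUSCCStarBundle.continuous_star (A := A)).comp hf

/-- The section algebra `Γ₀(X, 𝒜)`: the continuous sections that vanish at infinity. -/
def sectionAlgebra [IsUSCCStarBundle A] : NonUnitalStarSubalgebra ℂ (lp A ∞) :=
  boundedSections A ⊓ sectionsVanishing A (cocompact X)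

variable {A}

/-- Evaluation `f ↦ f(x)` of bounded sections at the point `x`, restricted to a subalgebra. -/
def evalAt (B : NonUnitalStarSubalgebra ℂ (lp A ∞)) (x : X) : B →⋆ₙₐ[ℂ] A x where
  toFun f := (f : lp A ∞) x
  map_smul' _ _ := rfl
  map_zero' := rfl
  map_add' _ _ := rfl
  map_mul' _ _ := rfl
  map_star' _ := rfl

variable (A)

lemma isClosed_boundedSections [IsUSCCStarBundle A] :
    IsClosed (boundedSections A : Set (lp A ∞)) := by
  refine isClosed_of_closure_subset fun f hf => ?_
  refine continuous_iff_continuousAt.2 fun x₀ => ?_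
  intro O hO
  -- addition is continuous at `(f x₀, 0)`
  have hadd := (IsUSCCStarBundle.continuous_add (A := A)).tendsto ⟨x₀, f x₀, 0⟩
  simp only [add_zero] at hadd
  have h1 := hadd hO
  rw [mem_map, nhds_induced, mem_comap] at h1
  obtain ⟨W, hW, hWO⟩ := h1
  rw [nhds_prod_eq, mem_prod_iff] at hW
  obtain ⟨O', hO', V, hV, hOV'⟩ := hW
  obtain ⟨O₁, hO₁s, hO₁o, hO₁m⟩ := mem_nhds_iff.1 hO'
  have hO₁ := hO₁o.mem_nhds hO₁m
  have hOV : O₁ ×ˢ V ⊆ W := (Set.prod_mono hO₁s subset_rfl).trans hOV'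
  have h2 := IsUSCCStarBundle.tendsto_zero (A := A) x₀ hV
  rw [mem_inf_iff_superset] at h2
  obtain ⟨S, hS, U', hU', hSU⟩ := h2
  obtain ⟨S', hS', hSS⟩ := mem_comap.1 hS
  obtain ⟨U, hU, hUU⟩ := mem_comap.1 hU'
  obtain ⟨δ, hδ, hball⟩ := Metric.mem_nhds_iff.1 hS'
  -- the fibre over `x₀` maps continuously into the total space
  have hfib : Tendsto (fun z : A x₀ => (⟨x₀, z⟩ : Tot A)) (𝓝 (f x₀)) (𝓝 ⟨x₀, f x₀⟩) := by
    have hz : Tendsto (fun z : A x₀ => (⟨x₀, z - f x₀⟩ : Tot A)) (𝓝 (f x₀)) (𝓝 ⟨x₀, 0⟩) := by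
      refine Tendsto.mono_right ?_ (IsUSCCStarBundle.tendsto_zero (A := A) x₀)
      refine tendsto_inf.2 ⟨tendsto_comap_iff.2 ?_, tendsto_comap_iff.2 tendsto_const_nhds⟩
      exact tendsto_iff_norm_sub_tendsto_zero.1 tendsto_id
    have hp : Tendsto (fun z : A x₀ => (⟨x₀, f x₀, z - f x₀⟩ : FibrePair A)) (𝓝 (f x₀))
        (𝓝 ⟨x₀, f x₀, 0⟩) := by
      rw [nhds_induced, tendsto_comap_iff, nhds_prod_eq]
      exact tendsto_const_nhds.prodMk hz
    have := hadd.comp hp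
    refine this.congr fun z => ?_
    simp
  obtain ⟨η, hη, hηb⟩ := Metric.mem_nhds_iff.1 (hfib hO₁)
  obtain ⟨g, hg, hfg⟩ := Metric.mem_closure_iff.1 hf (min δ η) (lt_min hδ hη)
  have hpt : ∀ x, ‖f x - g x‖ < min δ η := fun x => by
    have := lp.norm_apply_le_norm ENNReal.top_ne_zero (f - g) x
    rw [dist_eq_norm] at hfg
    exact lt_of_le_of_lt this hfg
  have hg0 : (⟨x₀, g x₀⟩ : Tot A) ∈ O₁ := by
    refine hηb ?_
    rw [Metric.mem_ball, dist_comm, dist_eq_norm]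
    exact (hpt x₀).trans_le (min_le_right _ _)
  have hgO : ∀ᶠ y in 𝓝 x₀, (⟨y, g y⟩ : Tot A) ∈ O₁ :=
    (Continuous.tendsto (show Continuous (fun x => (⟨x, g x⟩ : Tot A)) from hg) x₀)
      (hO₁o.mem_nhds hg0)
  change ∀ᶠ y in 𝓝 x₀, (⟨y, f y⟩ : Tot A) ∈ O
  filter_upwards [hgO, hU] with y hy hyU
  have : (⟨y, g y, f y - g y⟩ : FibrePair A) ∈
      (fun p : FibrePair A => (⟨p.base, p.fst + p.snd⟩ : Tot A)) ⁻¹' O := by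
    apply hWO
    apply hOV
    refine ⟨hy, hSU ⟨hSS (hball ?_), hUU hyU⟩⟩
    simpa using (hpt y).trans_le (min_le_left _ _)
  simpa using this

/-- `Γ₀(X, 𝒜)` is norm closed, hence a `C*`-algebra. -/
instance isClosed_sectionAlgebra [IsUSCCStarBundle A] :
    IsClosed (sectionAlgebra A : Set (lp A ∞)) :=
  (isClosed_boundedSections A).inter (isClosed_sectionsVanishing A _)

end Bundle

/-! ## Topological groupoids

A groupoid is a Mathlib `Groupoid` with object set (unit space) `X`; the set `E` of all its arrows
is `Quiver.Total X`. An arrow `γ : x ⟶ y` has source `s(γ) = x` and range `r(γ) = y`, so the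
product `γη` of the literature is `η ≫ γ`. -/

section Groupoid

variable (X : Type u) [Groupoid.{v} X]

/-- The arrow space `E`. -/
abbrev Arrows : Type (max u v) := Quiver.Total X

/-- The set of composable pairs of arrows. -/
structure ComposablePair where
  {x y z : X}
  fst : x ⟶ y
  snd : y ⟶ z

/-- The composable pairs carry the relative topology of `E × E`. -/
instance [TopologicalSpace (Arrows X)] : TopologicalSpace (ComposablePair X) :=
  TopologicalSpace.induced
    (fun p => ((⟨_, _, p.fst⟩ : Arrows X), (⟨_, _, p.snd⟩ : Arrows X))) inferInstance

/-- Composition and inversion are continuous, and the unit space carries the relative topology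
coming from its identification with the set of identity arrows. -/
class IsTopologicalGroupoid [TopologicalSpace X] [TopologicalSpace (Arrows X)] : Prop where
  continuous_comp : Continuous (fun p : ComposablePair X => (⟨_, _, p.fst ≫ p.snd⟩ : Arrows X))
  continuous_inv : Continuous (fun γ : Arrows X => (⟨_, _, Groupoid.inv γ.hom⟩ : Arrows X))
  isEmbedding_unit : IsEmbedding (fun x : X => (⟨x, x, 𝟙 x⟩ : Arrows X))

/-- The action of `E` on its unit space is free. -/
def IsPrincipal : Prop := ∀ (x : X) (γ : x ⟶ x), γ = 𝟙 x

/-- The action of `E` on its unit space is proper: `{γ | γ K ∩ L ≠ ∅}` is compact for all compact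
sets `K` and `L` of units. -/
def IsProperGroupoid [TopologicalSpace X] [TopologicalSpace (Arrows X)] : Prop :=
  ∀ K L : Set X, IsCompact K → IsCompact L →
    IsCompact {γ : Arrows X | γ.left ∈ K ∧ γ.right ∈ L}

/-- Two units are in the same orbit when there is an arrow between them. -/
def orbitSetoid : Setoid X where
  r x y := Nonempty (x ⟶ y)
  iseqv := ⟨fun x => ⟨𝟙 x⟩, fun ⟨γ⟩ => ⟨Groupoid.inv γ⟩, fun ⟨γ⟩ ⟨η⟩ => ⟨γ ≫ η⟩⟩

/-- The orbit space `E \ E⁰` of the unit space, with the quotient topology. -/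
abbrev UnitOrbits : Type u := Quotient (orbitSetoid X)

variable {X}

open Classical in
/-- For `η : x ⟶ y`, the function `γ ↦ f(ηγ)` on the arrows with range `x`, extended by `0`. -/
def leftTranslate {x y : X} (η : x ⟶ y) (f : Arrows X → ℂ) (γ : Arrows X) : ℂ :=
  if h : γ.right = x then f ⟨γ.left, y, γ.hom ≫ eqToHom h ≫ η⟩ else 0

variable (X)

/-- A (left) Haar system. On the second countable locally compact Hausdorff space of arrows the
Radon measures are the Borel measures that are finite on compact sets. -/
structure HaarSystem [TopologicalSpace X] [TopologicalSpace (Arrows X)]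
    [MeasurableSpace (Arrows X)] where
  measure : X → Measure (Arrows X)
  finite_on_compacts : ∀ x, IsFiniteMeasureOnCompacts (measure x)
  support_eq : ∀ x, (measure x).support = {γ | γ.right = x}
  continuous_integral : ∀ f : Arrows X → ℂ, Continuous f → HasCompactSupport f →
    Continuous (fun x => ∫ γ, f γ ∂(measure x))
  left_invariant : ∀ {x y : X} (η : x ⟶ y) (f : Arrows X → ℂ), Continuous f →
    HasCompactSupport f → ∫ γ, leftTranslate η f γ ∂(measure x) = ∫ γ, f γ ∂(measure y)

end Groupoid

/-! ## Groupoid actions on bundles and induced algebras -/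

section Dynamical

variable {X : Type u} [Groupoid.{v} X] [TopologicalSpace (Arrows X)]

/-- The fibred product `E * 𝒜 = {(γ, a) | s(γ) = p(a)}`. -/
structure ArrowPair (A : X → Type w) where
  {src tgt : X}
  hom : src ⟶ tgt
  val : A src

/-- `E * 𝒜` carries the relative topology of `E × 𝒜`. -/
instance (A : X → Type w) [TopologicalSpace (Tot A)] : TopologicalSpace (ArrowPair A) :=
  TopologicalSpace.induced
    (fun p => ((⟨_, _, p.hom⟩ : Arrows X), (⟨_, p.val⟩ : Tot A))) inferInstance

variable (A : X → Type w) [∀ x, NonUnitalCStarAlgebra (A x)] [TopologicalSpace (Tot A)]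

/-- A continuous action `α` of the groupoid on the bundle by (automatically isometric)
`*`-isomorphisms `α_γ : A(s(γ)) → A(r(γ))`. -/
structure BundleAction where
  map : ∀ {x y : X}, (x ⟶ y) → (A x ≃⋆ₐ[ℂ] A y)
  map_comp : ∀ {x y z : X} (η : x ⟶ y) (γ : y ⟶ z) (a : A x),
    map (η ≫ γ) a = map γ (map η a)
  continuous_map : Continuous (fun p : ArrowPair A => (⟨p.tgt, map p.hom p.val⟩ : Tot A))

variable {A}

/-- The bounded sections `f` with `f(r(γ)) = α_γ(f(s(γ)))` for all `γ`. -/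
def equivariantSections (α : BundleAction A) : NonUnitalStarSubalgebra ℂ (lp A ∞) where
  carrier := {f | ∀ (x y : X) (γ : x ⟶ y), f y = α.map γ (f x)}
  add_mem' {f g} hf hg x y γ :=
    (congrArg₂ (· + ·) (hf x y γ) (hg x y γ)).trans (map_add (α.map γ) (f x) (g x)).symm
  zero_mem' _ _ γ := (map_zero (α.map γ)).symm
  mul_mem' {f g} hf hg x y γ :=
    (congrArg₂ (· * ·) (hf x y γ) (hg x y γ)).trans (map_mul (α.map γ) (f x) (g x)).symm
  smul_mem' c f hf x y γ :=
    (congrArg (c • ·) (hf x y γ)).trans (map_smul (α.map γ) c (f x)).symm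
  star_mem' {f} hf x y γ := (congrArg star (hf x y γ)).trans (map_star (α.map γ) (f x)).symm

lemma isClosed_equivariantSections (α : BundleAction A) :
    IsClosed (equivariantSections α : Set (lp A ∞)) := by
  have hev : ∀ x, Continuous (fun f : lp A ∞ => f x) := fun x => by
    refine Metric.continuous_iff.2 fun g ε hε => ⟨ε, hε, fun f hf => ?_⟩
    rw [dist_eq_norm] at hf ⊢
    exact lt_of_le_of_lt (lp.norm_apply_le_norm ENNReal.top_ne_zero (f - g) x) hf
  have : (equivariantSections α : Set (lp A ∞)) =
      ⋂ (x : X) (y : X) (γ : x ⟶ y), {f : lp A ∞ | f y = α.map γ (f x)} := by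
    ext f
    simp only [Set.mem_iInter]
    rfl
  rw [this]
  refine isClosed_iInter fun x => isClosed_iInter fun y => isClosed_iInter fun γ => ?_
  refine isClosed_eq (hev y) (Continuous.comp ?_ (hev x))
  exact (StarAlgEquiv.isometry (α.map γ)).continuous

variable [TopologicalSpace X] [IsUSCCStarBundle A]

/-- The induced algebra `Ind(A, α)`: the bounded continuous sections `f` with
`f(r(γ)) = α_γ(f(s(γ)))` such that `E·x ↦ ‖f(x)‖` vanishes at infinity on the orbit space. -/
def inducedAlgebra (α : BundleAction A) : NonUnitalStarSubalgebra ℂ (lp A ∞) :=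
  boundedSections A ⊓ equivariantSections α ⊓
    sectionsVanishing A (comap (Quotient.mk (orbitSetoid X)) (cocompact (UnitOrbits X)))

/-- `Ind(A, α)` is norm closed, hence a `C*`-algebra. -/
instance isClosed_inducedAlgebra (α : BundleAction A) :
    IsClosed (inducedAlgebra α : Set (lp A ∞)) :=
  ((isClosed_boundedSections A).inter (isClosed_equivariantSections α)).inter
    (isClosed_sectionsVanishing A _)

end Dynamical

/-! ## The spectrum of a `C*`-algebra -/

section Spectrum

/-- A `*`-representation on a Hilbert space is irreducible when it is nonzero and has no closed
invariant subspaces other than `0` and the whole space. -/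
def IsIrreducibleRep {B : Type w} [NonUnitalCStarAlgebra B] {H : Type t} [NormedAddCommGroup H]
    [InnerProductSpace ℂ H] [CompleteSpace H] (π : B →⋆ₙₐ[ℂ] (H →L[ℂ] H)) : Prop :=
  π ≠ 0 ∧ ∀ K : Submodule ℂ H, IsClosed (K : Set H) → (∀ b, ∀ ξ ∈ K, π b ξ ∈ K) → K = ⊥ ∨ K = ⊤

/-- An irreducible `*`-representation of `B` on some Hilbert space. (Irreducible representations of
separable `C*`-algebras live on separable Hilbert spaces, so every universe of Hilbert spaces
contains all of them up to unitary equivalence.) -/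
structure IrrRep (B : Type w) [NonUnitalCStarAlgebra B] where
  H : Type t
  [normedAddCommGroup : NormedAddCommGroup H]
  [innerProductSpace : InnerProductSpace ℂ H]
  [completeSpace : CompleteSpace H]
  rep : B →⋆ₙₐ[ℂ] (H →L[ℂ] H)
  irreducible : IsIrreducibleRep rep

attribute [instance] IrrRep.normedAddCommGroup IrrRep.innerProductSpace IrrRep.completeSpace

/-- Unitary equivalence of irreducible representations. -/
def unitaryEquiv (B : Type w) [NonUnitalCStarAlgebra B] : Setoid (IrrRep.{w, t} B) where
  r π ρ := ∃ U : π.H ≃ₗᵢ[ℂ] ρ.H, ∀ b ξ, U (π.rep b ξ) = ρ.rep b (U ξ)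
  iseqv :=
    { refl := fun π => ⟨LinearIsometryEquiv.refl ℂ π.H, fun _ _ => rfl⟩
      symm := fun {π ρ} ⟨U, hU⟩ => ⟨U.symm, fun b ξ => by
        rw [LinearIsometryEquiv.symm_apply_eq, hU, LinearIsometryEquiv.apply_symm_apply]⟩
      trans := fun {π ρ τ} ⟨U, hU⟩ ⟨V, hV⟩ => ⟨U.trans V, fun b ξ => by
        simp only [LinearIsometryEquiv.trans_apply, hU, hV]⟩ }

/-- The spectrum of `B`: the set of unitary equivalence classes of irreducible representations. -/
def Spectrum (B : Type w) [NonUnitalCStarAlgebra B] : Type (max w (t + 1)) :=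
  Quotient (unitaryEquiv.{w, t} B)

/-- The class of an irreducible representation in the spectrum. -/
def IrrRep.toSpectrum {B : Type w} [NonUnitalCStarAlgebra B] (π : IrrRep.{w, t} B) :
    Spectrum.{w, t} B :=
  Quotient.mk (unitaryEquiv B) π

/-- The hull-kernel topology: the open sets are the sets `{[π] | π(J) ≠ 0}`, where `J` runs over
the closed two-sided ideals of `B`. -/
instance (B : Type w) [NonUnitalCStarAlgebra B] : TopologicalSpace (Spectrum.{w, t} B) :=
  TopologicalSpace.generateFrom
    {O | ∃ J : Submodule ℂ B, IsClosed (J : Set B) ∧ (∀ a, ∀ b ∈ J, a * b ∈ J ∧ b * a ∈ J) ∧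
      O = {p | ∃ π : IrrRep.{w, t} B, π.toSpectrum = p ∧ ∃ b ∈ J, π.rep b ≠ 0}}

end Spectrum

/-! ## The action on the spectrum and its orbit space -/

section Orbits

variable {X : Type u} [Groupoid.{v} X] [TopologicalSpace (Arrows X)] [TopologicalSpace X]
  {A : X → Type w} [∀ x, NonUnitalCStarAlgebra (A x)] [TopologicalSpace (Tot A)]
  [IsUSCCStarBundle A]

/-- The map `α_γ⁻¹ : A(r(γ)) → A(s(γ))`. -/
def BundleAction.invMap (α : BundleAction A) {x y : X} (γ : x ⟶ y) : A y →⋆ₙₐ[ℂ] A x :=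
  ((α.map γ).symm : A y →⋆ₙₐ[ℂ] A x)

/-- `π = τ ∘ ε_x` on `Γ₀(X, 𝒜)`: the representation `π` lies over the point `x`, and `τ` is the
representation of the fibre `A(x)` through which it factors. -/
def FactorsThrough (π : IrrRep.{max u w, t} (sectionAlgebra A)) (x : X)
    (τ : A x →⋆ₙₐ[ℂ] (π.H →L[ℂ] π.H)) : Prop :=
  π.rep = τ.comp (evalAt (sectionAlgebra A) x)

/-- `p` and `q` are in the same orbit of the action `γ · (τ ∘ ε_{s(γ)}) = τ ∘ α_γ⁻¹ ∘ ε_{r(γ)}` of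
the groupoid on the spectrum of `Γ₀(X, 𝒜)`: `q = γ · p` for some `γ`. -/
def OrbitRel (α : BundleAction A) (p q : Spectrum.{max u w, t} (sectionAlgebra A)) : Prop :=
  ∃ (π : IrrRep.{max u w, t} (sectionAlgebra A)) (x y : X) (γ : x ⟶ y)
    (τ : A x →⋆ₙₐ[ℂ] (π.H →L[ℂ] π.H)),
    π.toSpectrum = p ∧ FactorsThrough π x τ ∧
    ∃ h : IsIrreducibleRep ((τ.comp (α.invMap γ)).comp (evalAt (sectionAlgebra A) y)),
      (IrrRep.mk π.H _ h).toSpectrum = q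

/-- The orbit space of the spectrum of `Γ₀(X, 𝒜)`, with the quotient topology. -/
abbrev SpectrumOrbits (α : BundleAction A) : Type _ := Quot (OrbitRel.{u, v, w, t} α)

end Orbits

end IndAlg

end

open IndAlg

set_option linter.unusedSectionVars false

noncomputable section

namespace IndAlg

/-! ## Continuous sections of upper semicontinuous `C*`-bundles -/

section BundleSections

variable {X : Type u} [TopologicalSpace X] {A : X → Type w} [∀ x, NonUnitalCStarAlgebra (A x)]
  [TopologicalSpace (Tot A)]

/-! The induced algebra is itself a section algebra, over the orbit space, and the theorem compares
the two section algebras fibre by fibre.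

Because the groupoid is principal, there is exactly one arrow between two units of an orbit, so the
fibres along an orbit are canonically identified and the bundle descends to a family `OrbitFibre`
over the orbits. Properness makes arrows with source and range near a unit close to that unit;
together with the openness of source and range, which comes from the Haar system, this makes the
quotient an upper semicontinuous bundle (`isUSCCStarBundle_orbitFibre`) over a locally compact
Hausdorff space. Restriction to orbit representatives identifies the induced algebra with its
section algebra (`toOrbitSections_injective`, `toOrbitSections_surjective`).

Two facts hold for any section algebra over a paracompact locally compact Hausdorff base.
Evaluations are onto the fibres, by the existence of continuous sections
(`exists_continuous_section`), and an irreducible representation factors through evaluation at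
exactly one point, since sections with disjoint supports annihilate each other and kernels of
irreducible representations are prime. Applied to both bundles, they show that the irreducible
representations of either algebra are `τ ∘ ε_x` with `τ` an irreducible representation of `A x`. On
the induced algebra two of these are equivalent exactly when an arrow and a unitary intertwine them,
which is also the description of the orbit relation (`orbitRel_mk_iff`,
`induced_toSpectrum_eq_iff`). Hence induction is a bijection from orbits to the spectrum.

Continuity follows by cutting an invariant section off to compact support. For openness, an element
`a` separating a point from a closed invariant set is replaced by an invariant section with the same
value at one unit, cut off to orbits passing where it is close to `a`. The invariant section is then
small, not zero, on the closed set, and functional calculus removes the error. -/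

lemma exists_nhds_of_fibrePair {p : FibrePair A} {S : Set (FibrePair A)} (hS : S ∈ 𝓝 p) :
    ∃ U ∈ 𝓝 (⟨p.base, p.fst⟩ : Tot A), ∃ V ∈ 𝓝 (⟨p.base, p.snd⟩ : Tot A),
      ∀ (y : X) (a b : A y), (⟨y, a⟩ : Tot A) ∈ U → (⟨y, b⟩ : Tot A) ∈ V →
        (⟨y, a, b⟩ : FibrePair A) ∈ S := by
  rw [nhds_induced, mem_comap] at hS
  obtain ⟨W, hW, hWS⟩ := hS
  rw [nhds_prod_eq, mem_prod_iff] at hW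
  obtain ⟨U, hU, V, hV, hUV⟩ := hW
  exact ⟨U, hU, V, hV, fun y a b ha hb => hWS (hUV ⟨ha, hb⟩)⟩

variable [IsUSCCStarBundle A]

lemma exists_nhds_add_mem {x : X} {a b : A x} {W : Set (Tot A)}
    (hW : W ∈ 𝓝 (⟨x, a + b⟩ : Tot A)) :
    ∃ U ∈ 𝓝 (⟨x, a⟩ : Tot A), ∃ V ∈ 𝓝 (⟨x, b⟩ : Tot A),
      ∀ (y : X) (a' b' : A y), (⟨y, a'⟩ : Tot A) ∈ U → (⟨y, b'⟩ : Tot A) ∈ V →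
        (⟨y, a' + b'⟩ : Tot A) ∈ W :=
  exists_nhds_of_fibrePair
    ((IsUSCCStarBundle.continuous_add (A := A)).continuousAt (x := ⟨x, a, b⟩) hW)

lemma eventually_norm_lt {x : X} {a : A x} {δ : ℝ} (h : ‖a‖ < δ) :
    ∀ᶠ z : Tot A in 𝓝 ⟨x, a⟩, ‖z.snd‖ < δ :=
  IsUSCCStarBundle.usc_norm (A := A) ⟨x, a⟩ δ h

/-- Subtraction is continuous and the norm is upper semicontinuous. With `a = b` this yields thin
neighbourhoods: two of their points in a common fibre are `δ`-close. They replace balls, since the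
total space has no metric. -/
lemma exists_nhds_norm_sub_lt {x : X} {a b : A x} {δ : ℝ} (h : ‖a - b‖ < δ) :
    ∃ U ∈ 𝓝 (⟨x, a⟩ : Tot A), ∃ V ∈ 𝓝 (⟨x, b⟩ : Tot A),
      ∀ (y : X) (a' b' : A y), (⟨y, a'⟩ : Tot A) ∈ U → (⟨y, b'⟩ : Tot A) ∈ V →
        ‖a' - b'‖ < δ := by
  rw [sub_eq_add_neg] at h
  obtain ⟨U, hU, V, hV, hUV⟩ := exists_nhds_add_mem (eventually_norm_lt h)
  have hs := (IsUSCCStarBundle.continuous_smul (A := A) (-1)).continuousAt (x := ⟨x, b⟩)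
  rw [ContinuousAt] at hs
  simp only [neg_smul, one_smul] at hs
  refine ⟨U, hU, _, hs hV, fun y a' b' ha hb => ?_⟩
  rw [sub_eq_add_neg]
  exact hUV y a' (-b') ha hb

lemma eventually_exists_mem {x : X} {a : A x} {U : Set (Tot A)} (hU : U ∈ 𝓝 (⟨x, a⟩ : Tot A)) :
    ∀ᶠ y in 𝓝 x, ∃ b : A y, (⟨y, b⟩ : Tot A) ∈ U := by
  have := (IsUSCCStarBundle.isOpenMap_proj (A := A)).image_mem_nhds hU
  filter_upwards [this] with y hy
  obtain ⟨⟨y', b⟩, hb, rfl⟩ := hy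
  exact ⟨b, hb⟩

lemma tendsto_proj (z : Tot A) : Tendsto (fun z : Tot A => z.proj) (𝓝 z) (𝓝 z.proj) :=
  (IsUSCCStarBundle.continuous_proj (A := A)).tendsto z

/-- Continuity of addition at `(a, 0)`, combined with the axiom that small vectors over points near
`x` are near `0` in the fibre over `x`. -/
lemma exists_add_mem_of_norm_lt {x : X} {a : A x} {W : Set (Tot A)}
    (hW : W ∈ 𝓝 (⟨x, a⟩ : Tot A)) :
    ∃ U ∈ 𝓝 (⟨x, a⟩ : Tot A), ∃ δ > 0, ∃ P ∈ 𝓝 x, ∀ (y : X) (a' b' : A y),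
      (⟨y, a'⟩ : Tot A) ∈ U → y ∈ P → ‖b'‖ < δ → (⟨y, a' + b'⟩ : Tot A) ∈ W := by
  rw [← add_zero a] at hW
  obtain ⟨U, hU, V, hV, hUV⟩ := exists_nhds_add_mem hW
  have h := IsUSCCStarBundle.tendsto_zero (A := A) x hV
  rw [mem_inf_iff_superset] at h
  obtain ⟨S, hS, T, hT, hST⟩ := h
  obtain ⟨S', hS', hSS⟩ := mem_comap.1 hS
  obtain ⟨P, hP, hPT⟩ := mem_comap.1 hT
  obtain ⟨δ, hδ, hball⟩ := Metric.mem_nhds_iff.1 hS'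
  refine ⟨U, hU, δ, hδ, P, hP, fun y a' b' ha hy hb => hUV y a' b' ha ?_⟩
  exact hST ⟨hSS (hball (by simpa using hb)), hPT hy⟩

/-- Near `a` in the total space, the section `f` is within `ε` of the points of the total space. -/
def ApproxAt (f : ∀ x, A x) {x : X} (a : A x) (ε : ℝ) : Prop :=
  ∀ᶠ z : Tot A in 𝓝 ⟨x, a⟩, ‖z.snd - f z.proj‖ < ε

/-! ### Stability of approximate continuity -/

namespace ApproxAt

variable {f g : ∀ x, A x} {x : X} {a b : A x} {ε δ : ℝ}

lemma norm_lt (h : ApproxAt f a ε) : ‖a - f x‖ < ε := h.self_of_nhds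

lemma pos (h : ApproxAt f a ε) : 0 < ε := (norm_nonneg _).trans_lt h.norm_lt

lemma mono (h : ApproxAt f a ε) (hε : ε ≤ δ) : ApproxAt f a δ :=
  Eventually.mono h fun _ hz => hz.trans_le hε

/-- A point `z` near `a + b` need not split as a sum. Openness of the projection supplies `p` near
`a` and `q` near `b` in the fibre of `z`, and a thin neighbourhood of `a + b` bounds `z - (p + q)`
by `η`. -/
lemma add (hf : ApproxAt f a ε) (hg : ApproxAt g b δ) {η : ℝ} (hη : 0 < η) :
    ApproxAt (fun y => f y + g y) (a + b) (ε + δ + η) := by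
  obtain ⟨Z, hZ, W, hW, hZW⟩ := exists_nhds_norm_sub_lt (a := a + b) (b := a + b)
    (δ := η) (by simpa using hη)
  obtain ⟨U, hU, V, hV, hUV⟩ := exists_nhds_add_mem hW
  have h1 := (tendsto_proj (⟨x, a + b⟩ : Tot A)).eventually
    (eventually_exists_mem (inter_mem hU hf))
  have h2 := (tendsto_proj (⟨x, a + b⟩ : Tot A)).eventually
    (eventually_exists_mem (inter_mem hV hg))
  filter_upwards [h1, h2, hZ] with ⟨y, z⟩ ⟨p, hpU, hp⟩ ⟨q, hqV, hq⟩ hz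
  have h3 := hZW y z (p + q) hz (hUV y p q hpU hqV)
  change ‖p - f y‖ < ε at hp
  change ‖q - g y‖ < δ at hq
  change ‖z - (f y + g y)‖ < _
  calc ‖z - (f y + g y)‖ = ‖(p - f y) + (q - g y) + (z - (p + q))‖ := by congr 1; abel
    _ ≤ ‖p - f y‖ + ‖q - g y‖ + ‖z - (p + q)‖ := norm_add₃_le
    _ < _ := by linarith

lemma smul (hf : ApproxAt f a ε) {φ : X → ℝ} (hφ : ContinuousAt φ x) {η : ℝ} (hη : 0 < η) :
    ApproxAt (fun y => (φ y : ℂ) • f y) ((φ x : ℂ) • a) (|φ x| * ε + η) := by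
  obtain ⟨Z, hZ, W, hW, hZW⟩ := exists_nhds_norm_sub_lt (a := (φ x : ℂ) • a)
    (b := (φ x : ℂ) • a) (δ := η / 2) (by simpa using half_pos hη)
  have hs := (IsUSCCStarBundle.continuous_smul (A := A) (φ x : ℂ)).continuousAt (x := ⟨x, a⟩) hW
  have h1 := (tendsto_proj (⟨x, (φ x : ℂ) • a⟩ : Tot A)).eventually (eventually_exists_mem
    (inter_mem (inter_mem hs hf) (eventually_norm_lt (lt_add_one ‖a‖))))
  have hε := hf.pos
  -- This constant bounds `‖f y‖` near `x`; it absorbs the variation of `φ`, as only multiplication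
  -- by a fixed scalar is known to be continuous.
  have hC : 0 < ‖a‖ + 1 + ε := by positivity
  have h2 := (tendsto_proj (⟨x, (φ x : ℂ) • a⟩ : Tot A)).eventually
    (Metric.tendsto_nhds.1 hφ (η / 2 / (‖a‖ + 1 + ε)) (by positivity))
  filter_upwards [h1, h2, hZ] with ⟨y, z⟩ ⟨p, ⟨hpW, hp⟩, hpn⟩ hy hz
  change ‖p - f y‖ < ε at hp
  change ‖p‖ < ‖a‖ + 1 at hpn
  change dist (φ y) (φ x) < _ at hy
  change ‖z - (φ y : ℂ) • f y‖ < _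
  have h3 := hZW y z ((φ x : ℂ) • p) hz hpW
  rw [Real.dist_eq, lt_div_iff₀ hC, abs_sub_comm] at hy
  have hcx : ‖(φ x : ℂ)‖ = |φ x| := by simp
  have hcd : ‖((φ x - φ y : ℝ) : ℂ)‖ = |φ x - φ y| := by
    rw [Complex.norm_real, Real.norm_eq_abs]
  have key : z - (φ y : ℂ) • f y = (z - (φ x : ℂ) • p) + ((φ x - φ y : ℝ) : ℂ) • (p - (p - f y))
      + (φ x : ℂ) • (p - f y) := by
    rw [Complex.ofReal_sub]
    simp only [sub_smul, smul_sub]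
    abel
  have h4 : ‖((φ x - φ y : ℝ) : ℂ) • (p - (p - f y))‖ ≤ |φ x - φ y| * (‖a‖ + 1 + ε) := by
    rw [norm_smul, hcd]
    exact mul_le_mul_of_nonneg_left ((norm_sub_le _ _).trans (by linarith)) (abs_nonneg _)
  have h5 : ‖(φ x : ℂ) • (p - f y)‖ ≤ |φ x| * ε := by
    rw [norm_smul, hcx]
    exact mul_le_mul_of_nonneg_left hp.le (abs_nonneg _)
  rw [key]
  refine norm_add₃_le.trans_lt ?_
  linarith

lemma zero (x : X) {η : ℝ} (hη : 0 < η) : ApproxAt (fun y => (0 : A y)) (0 : A x) η := by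
  unfold ApproxAt
  simp only [sub_zero]
  exact eventually_norm_lt (by simpa using hη)

lemma sum {ι : Type*} (s : Finset ι) {f : ι → ∀ y, A y} {a : ι → A x}
    (h : ∀ i ∈ s, ApproxAt (f i) (a i) ε) {φ : ι → X → ℝ} (hφ : ∀ i, Continuous (φ i))
    {η : ℝ} (hη : 0 < η) :
    ApproxAt (fun y => ∑ i ∈ s, (φ i y : ℂ) • f i y) (∑ i ∈ s, (φ i x : ℂ) • a i)
      ((∑ i ∈ s, |φ i x|) * ε + η) := by
  classical
  induction s using Finset.induction_on generalizing η with
  | empty => simpa using zero x hη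
  | insert i s hi ih =>
    simp only [Finset.sum_insert hi]
    have h1 := (h i (Finset.mem_insert_self i s)).smul (hφ i).continuousAt
      (show 0 < η / 3 by positivity)
    have h2 := ih (fun j hj => h j (Finset.mem_insert_of_mem hj)) (show 0 < η / 3 by positivity)
    exact (h1.add h2 (show 0 < η / 3 by positivity)).mono (by linarith)

lemma of_norm_sub_lt (h : ApproxAt f a ε) (hab : ‖a - b‖ < δ) : ApproxAt f b (ε + δ) := by
  obtain ⟨U, hU, V, hV, hUV⟩ := exists_nhds_norm_sub_lt hab
  have h1 := (tendsto_proj (⟨x, b⟩ : Tot A)).eventually (eventually_exists_mem (inter_mem hU h))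
  filter_upwards [h1, hV] with ⟨y, z⟩ ⟨p, hpU, hp⟩ hz
  have h3 := hUV y p z hpU hz
  change ‖p - f y‖ < ε at hp
  change ‖z - f y‖ < _
  rw [norm_sub_rev] at h3
  calc ‖z - f y‖ = ‖(p - f y) + (z - p)‖ := by congr 1; abel
    _ ≤ _ := norm_add_le _ _
    _ < _ := add_lt_add hp h3

lemma of_dist_le (h : ApproxAt f a ε) (hfg : ∀ y, ‖f y - g y‖ ≤ δ) : ApproxAt g a (ε + δ) := by
  filter_upwards [h] with z hz
  calc ‖z.snd - g z.proj‖ = ‖(z.snd - f z.proj) + (f z.proj - g z.proj)‖ := by congr 1; abel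
    _ ≤ _ := norm_add_le _ _
    _ < _ := add_lt_add_of_lt_of_le hz (hfg _)

lemma congr (h : ApproxAt f a ε) (hfg : ∀ᶠ y in 𝓝 x, f y = g y) : ApproxAt g a ε := by
  filter_upwards [h, (tendsto_proj (⟨x, a⟩ : Tot A)).eventually hfg] with z hz hz'
  rwa [← hz']

end ApproxAt

/-- Thin neighbourhoods give one direction. For the other, openness of the projection provides `p`
over `y` near `f x`, and `f y = p + (f y - p)` is a small perturbation of it. -/
lemma continuousAt_section_iff {f : ∀ x, A x} {x : X} :
    ContinuousAt (fun y => (⟨y, f y⟩ : Tot A)) x ↔ ∀ ε > 0, ApproxAt f (f x) ε := by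
  refine ⟨fun hf ε hε => ?_, fun h W hW => ?_⟩
  · obtain ⟨U, hU, V, hV, hUV⟩ := exists_nhds_norm_sub_lt (a := f x) (b := f x) (δ := ε)
      (by simpa using hε)
    filter_upwards [hU, (tendsto_proj (⟨x, f x⟩ : Tot A)).eventually (hf hV)] with z hz hz'
    exact hUV z.proj z.snd _ hz hz'
  · obtain ⟨U, hU, δ, hδ, P, hP, hUP⟩ := exists_add_mem_of_norm_lt hW
    rw [mem_map]
    filter_upwards [eventually_exists_mem (inter_mem hU (h δ hδ)), hP] with y ⟨p, hpU, hp⟩ hy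
    change ‖p - f y‖ < δ at hp
    rw [norm_sub_rev] at hp
    have := hUP y p (f y - p) hpU hy hp
    rwa [add_sub_cancel] at this

lemma continuous_section_iff {f : ∀ x, A x} :
    Continuous (fun y => (⟨y, f y⟩ : Tot A)) ↔ ∀ x, ∀ ε > 0, ApproxAt f (f x) ε := by
  simp only [continuous_iff_continuousAt, continuousAt_section_iff]

lemma continuous_section_smul {f : ∀ x, A x} (hf : Continuous (fun y => (⟨y, f y⟩ : Tot A)))
    {φ : X → ℝ} (hφ : Continuous φ) :
    Continuous (fun y => (⟨y, (φ y : ℂ) • f y⟩ : Tot A)) := by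
  rw [continuous_section_iff] at hf ⊢
  intro x ε hε
  have h := (hf x (ε / 2 / (|φ x| + 1)) (by positivity)).smul hφ.continuousAt (half_pos hε)
  refine h.mono ?_
  have : |φ x| * (ε / 2 / (|φ x| + 1)) ≤ ε / 2 := by
    rw [mul_div_assoc', div_le_iff₀ (by positivity)]
    nlinarith
  linarith

lemma continuous_section_sub {f g : ∀ x, A x} (hf : Continuous (fun y => (⟨y, f y⟩ : Tot A)))
    (hg : Continuous (fun y => (⟨y, g y⟩ : Tot A))) :
    Continuous (fun y => (⟨y, f y - g y⟩ : Tot A)) := by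
  have hg' := (IsUSCCStarBundle.continuous_smul (A := A) (-1)).comp hg
  have := (IsUSCCStarBundle.continuous_add (A := A)).comp
    (g := fun p : FibrePair A => (⟨p.base, p.fst + p.snd⟩ : Tot A))
    (f := fun x => (⟨x, f x, (-1 : ℂ) • g x⟩ : FibrePair A))
    (continuous_induced_rng.2 (hf.prodMk hg'))
  refine this.congr fun x => ?_
  simp [sub_eq_add_neg]

lemma upperSemicontinuous_norm_section {f : ∀ x, A x}
    (hf : Continuous (fun y => (⟨y, f y⟩ : Tot A))) : UpperSemicontinuous fun x => ‖f x‖ :=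
  fun x c h => hf.continuousAt.eventually (IsUSCCStarBundle.usc_norm (A := A) ⟨x, f x⟩ c h)

/-! ### Continuous sections with a prescribed value -/

section Selection

/-- One step of the construction of a continuous section: an `ε`-continuous section is within `ε`
of a `δ`-continuous one with the same value at a given point. -/
lemma exists_approx_refinement [T2Space X] [ParacompactSpace X] (x₀ : X) {f : ∀ x, A x} {ε δ : ℝ}
    (hδ : 0 < δ) (hf : ∀ x, ApproxAt f (f x) ε) :
    ∃ g : ∀ x, A x, (∀ x, ApproxAt g (g x) δ) ∧ g x₀ = f x₀ ∧ ∀ x, ‖f x - g x‖ ≤ ε := by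
  classical
  have hloc : ∀ x, ∃ U : Set (Tot A), IsOpen U ∧ (⟨x, f x⟩ : Tot A) ∈ U ∧
      (∀ z ∈ U, ‖z.snd - f z.proj‖ < ε) ∧
      ∀ (y : X) (a b : A y), (⟨y, a⟩ : Tot A) ∈ U → (⟨y, b⟩ : Tot A) ∈ U → ‖a - b‖ < δ / 2 := by
    intro x
    obtain ⟨U, hU, V, hV, hUV⟩ := exists_nhds_norm_sub_lt (a := f x) (b := f x) (δ := δ / 2)
      (by simpa using half_pos hδ)
    obtain ⟨O, hO, hOo, hOm⟩ := mem_nhds_iff.1 (inter_mem (inter_mem hU hV) (hf x))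
    exact ⟨O, hOo, hOm, fun z hz => (hO hz).2, fun y a b ha hb =>
      hUV y a b (hO ha).1.1 (hO hb).1.2⟩
  choose U hUo hUm hUf hUthin using hloc
  -- The point `x₀` is removed from every chart except its own, so that the averaged section keeps
  -- its value there.
  let V : X → Set X := fun x => (fun z : Tot A => z.proj) '' U x ∩ {y | y = x₀ → x = x₀}
  have hVo : ∀ x, IsOpen (V x) := by
    intro x
    refine (IsUSCCStarBundle.isOpenMap_proj (A := A) _ (hUo x)).inter ?_
    by_cases hx : x = x₀
    · simp [hx]
    · simpa [hx] using isOpen_ne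
  have hVc : (Set.univ : Set X) ⊆ ⋃ x, V x := fun x _ =>
    Set.mem_iUnion.2 ⟨x, ⟨_, hUm x, rfl⟩, fun h => h⟩
  obtain ⟨ρ, hρ⟩ := PartitionOfUnity.exists_isSubordinate isClosed_univ V hVo hVc
  -- A pointwise choice without any continuity: thinness of `U x` alone makes it approximately
  -- continuous on `V x`. The value `0` off `V x` is never weighted.
  have hsel : ∀ x y, ∃ a : A y, y ∈ V x → (⟨y, a⟩ : Tot A) ∈ U x ∧ (y = x₀ → a = f y) := by
    intro x y
    by_cases hy : y ∈ V x
    · by_cases hy0 : y = x₀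
      · obtain rfl := hy0
        obtain rfl := hy.2 rfl
        exact ⟨f x, fun _ => ⟨hUm x, fun _ => rfl⟩⟩
      · obtain ⟨⟨⟨y', a⟩, ha, rfl⟩, -⟩ := hy
        exact ⟨a, fun _ => ⟨ha, fun h => absurd h hy0⟩⟩
    · exact ⟨0, fun h => absurd h hy⟩
  choose s hs using hsel
  have hsum : ∀ (x : X) (F : Finset X), ρ.finsupport x ⊆ F → ∑ i ∈ F, ρ i x = 1 :=
    fun x F hF => ρ.sum_finsupport' (Set.mem_univ x) hF
  have hmemV : ∀ {i x}, i ∈ ρ.fintsupport x → x ∈ V i := fun {i x} hi =>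
    hρ i ((ρ.mem_fintsupport_iff x i).1 hi)
  let g : ∀ x, A x := fun x => ∑ i ∈ ρ.finsupport x, (ρ i x : ℂ) • s i x
  have hg : ∀ (x : X) (F : Finset X), ρ.finsupport x ⊆ F →
      g x = ∑ i ∈ F, (ρ i x : ℂ) • s i x := by
    intro x F hF
    refine Finset.sum_subset hF fun i _ hi => ?_
    rw [ρ.mem_finsupport, Function.mem_support, not_not] at hi
    simp [hi]
  have habs : ∀ i x, |ρ i x| = ρ i x := fun i x => abs_of_nonneg (ρ.nonneg i x)
  have hconst : ∀ x (F : Finset X), ρ.finsupport x ⊆ F → ∀ a : A x,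
      ∑ i ∈ F, (ρ i x : ℂ) • a = a := by
    intro x F hF a
    rw [← Finset.sum_smul, ← Complex.ofReal_sum, hsum x F hF]
    simp
  refine ⟨g, fun x => ?_, ?_, fun x => ?_⟩
  -- The weights sum to `1`, so averaging selections that are `δ / 2`-continuous costs only the
  -- further `δ / 2`.
  · have h1 : ApproxAt (fun y => ∑ i ∈ ρ.fintsupport x, (ρ i y : ℂ) • s i y)
        (∑ i ∈ ρ.fintsupport x, (ρ i x : ℂ) • s i x)
        ((∑ i ∈ ρ.fintsupport x, |ρ i x|) * (δ / 2) + δ / 2) := by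
      refine ApproxAt.sum _ (fun i hi => ?_) (fun i => (ρ i).continuous) (half_pos hδ)
      have hx := (hs i x (hmemV hi)).1
      have hxV : ∀ᶠ y in 𝓝 x, y ∈ V i := (hVo i).mem_nhds (hmemV hi)
      filter_upwards [(hUo i).mem_nhds hx,
        (tendsto_proj (⟨x, s i x⟩ : Tot A)).eventually hxV] with z hz hz'
      exact hUthin i z.proj z.snd _ hz (hs i _ hz').1
    rw [← hg x _ (ρ.finsupport_subset_fintsupport x)] at h1
    simp only [habs] at h1
    rw [hsum x _ (ρ.finsupport_subset_fintsupport x), one_mul, add_halves] at h1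
    exact h1.congr ((ρ.eventually_finsupport_subset x).mono fun y hy => (hg y _ hy).symm)
  · have : g x₀ = ∑ i ∈ ρ.finsupport x₀, (ρ i x₀ : ℂ) • f x₀ := by
      refine Finset.sum_congr rfl fun i hi => ?_
      rw [(hs i x₀ (hmemV (ρ.finsupport_subset_fintsupport x₀ hi))).2 rfl]
    rw [this, hconst x₀ _ subset_rfl]
  · have h1 : f x - g x = ∑ i ∈ ρ.finsupport x, (ρ i x : ℂ) • (f x - s i x) := by
      simp only [smul_sub, Finset.sum_sub_distrib]
      rw [hconst x _ subset_rfl]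
    rw [h1]
    refine (norm_sum_le _ _).trans ?_
    have h2 : ∀ i ∈ ρ.finsupport x, ‖(ρ i x : ℂ) • (f x - s i x)‖ ≤ ρ i x * ε := by
      intro i hi
      have := hUf i _ (hs i x (hmemV (ρ.finsupport_subset_fintsupport x hi))).1
      rw [norm_smul, Complex.norm_real, Real.norm_eq_abs, habs, norm_sub_rev]
      exact mul_le_mul_of_nonneg_left this.le (ρ.nonneg i x)
    refine (Finset.sum_le_sum h2).trans ?_
    rw [← Finset.sum_mul, hsum x _ subset_rfl, one_mul]

/-- An upper semicontinuous `C*`-bundle over a paracompact Hausdorff space has enough bounded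
continuous sections (Douady, dal Soglio-Hérault, Hofmann). -/
theorem exists_continuous_section [T2Space X] [ParacompactSpace X] (x₀ : X) (a : A x₀) :
    ∃ f : ∀ x, A x, Continuous (fun x => (⟨x, f x⟩ : Tot A)) ∧ f x₀ = a ∧
      ∃ C, ∀ x, ‖f x‖ ≤ C := by
  classical
  -- The starting section is `a` at `x₀` and `0` elsewhere. Points near its graph have norm below
  -- `‖a‖ + 1` and its values have norm at most `‖a‖`, so it is `C`-continuous.
  set C : ℝ := ‖a‖ + 1 + ‖a‖ with hC
  have hCpos : 0 < C := by positivity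
  let f₀ : ∀ x, A x := Function.update 0 x₀ a
  have hf₀n : ∀ x, ‖f₀ x‖ ≤ ‖a‖ := by
    intro x
    by_cases hx : x = x₀
    · obtain rfl := hx
      simp [f₀]
    · simp [f₀, hx]
  have hf₀ : ∀ x, ApproxAt f₀ (f₀ x) C := by
    intro x
    filter_upwards [eventually_norm_lt ((hf₀n x).trans_lt (lt_add_one ‖a‖))] with z hz
    calc _ ≤ ‖z.snd‖ + ‖f₀ z.proj‖ := norm_sub_le _ _
      _ < C := add_lt_add_of_lt_of_le hz (hf₀n _)
  let S : ℕ → Type _ := fun n => {f : ∀ x, A x // ∀ x, ApproxAt f (f x) (C / 2 ^ n)}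
  have hstep : ∀ n (f : S n), ∃ g : S (n + 1), g.1 x₀ = f.1 x₀ ∧
      ∀ x, ‖f.1 x - g.1 x‖ ≤ C / 2 ^ n := by
    intro n f
    obtain ⟨g, hg, hg0, hfg⟩ := exists_approx_refinement x₀
      (show 0 < C / 2 ^ (n + 1) by positivity) f.2
    exact ⟨⟨g, hg⟩, hg0, hfg⟩
  choose step hstep0 hstepn using hstep
  let F : ∀ n, S n := fun n => Nat.rec ⟨f₀, by simpa using hf₀⟩ (fun n f => step n f) n
  have hF0 : ∀ n, (F n).1 x₀ = a := by
    intro n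
    induction n with
    | zero => simp [F, f₀]
    | succ n ih => rw [← ih]; exact hstep0 n (F n)
  have hd : ∀ x n, dist ((F n).1 x) ((F (n + 1)).1 x) ≤ 2 * C / 2 / 2 ^ n := by
    intro x n
    rw [dist_eq_norm, mul_div_cancel_left₀ C two_ne_zero]
    exact hstepn n (F n) x
  have hlim : ∀ x, ∃ l, Tendsto (fun n => (F n).1 x) atTop (𝓝 l) := fun x =>
    cauchySeq_tendsto_of_complete (cauchySeq_of_le_geometric_two (hd x))
  choose f hflim using hlim
  have hdist : ∀ n x, ‖(F n).1 x - f x‖ ≤ 2 * C / 2 ^ n := fun n x => by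
    rw [← dist_eq_norm]
    exact dist_le_of_le_geometric_two_of_tendsto (hd x) (hflim x) n
  refine ⟨f, ?_, ?_, ‖a‖ + 2 * C, fun x => ?_⟩
  · rw [continuous_section_iff]
    intro x ε hε
    -- In units of `C / 2 ^ n`: one for the continuity of `F n`, two for passing from `F n` to `f`
    -- near `x`, and three for moving the centre from `F n x` to `f x`, where the third unit makes
    -- the inequality strict.
    obtain ⟨n, hn⟩ : ∃ n : ℕ, 6 * C / 2 ^ n < ε := by
      obtain ⟨n, hn⟩ := pow_unbounded_of_one_lt (6 * C / ε) (one_lt_two (α := ℝ))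
      refine ⟨n, ?_⟩
      rw [div_lt_iff₀ hε] at hn
      rw [div_lt_iff₀ (by positivity)]
      linarith
    have hpos : 0 < C / 2 ^ n := by positivity
    have h1 := ((F n).2 x).of_dist_le (hdist n)
    have h2 := h1.of_norm_sub_lt (b := f x) (δ := 3 * C / 2 ^ n)
      ((hdist n x).trans_lt (by rw [mul_div_assoc, mul_div_assoc]; linarith))
    refine h2.mono ?_
    rw [mul_div_assoc, mul_div_assoc] at *
    linarith
  · refine tendsto_nhds_unique (hflim x₀) ?_
    simp only [hF0]
    exact tendsto_const_nhds
  · have h1 := hdist 0 x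
    have h2 := hf₀n x
    have h3 : (F 0).1 x = f₀ x := rfl
    rw [h3, pow_zero, div_one] at h1
    calc ‖f x‖ = ‖f₀ x - (f₀ x - f x)‖ := by congr 1; abel
      _ ≤ _ := norm_sub_le _ _
      _ ≤ _ := add_le_add h2 h1

end Selection

end BundleSections

/-! ## Irreducible representations -/

section Irreducible

variable {B : Type*} [NonUnitalCStarAlgebra B] {C : Type*} [NonUnitalCStarAlgebra C]
  {H : Type t} [NormedAddCommGroup H] [InnerProductSpace ℂ H] [CompleteSpace H]

/-- Irreducibility depends only on the range of a representation. -/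
lemma IsIrreducibleRep.of_range_eq {π : B →⋆ₙₐ[ℂ] (H →L[ℂ] H)} (hπ : IsIrreducibleRep π)
    {ρ : C →⋆ₙₐ[ℂ] (H →L[ℂ] H)} (h : Set.range π = Set.range ρ) : IsIrreducibleRep ρ := by
  have hmem : ∀ b, ∃ c, ρ c = π b := fun b => by
    have : π b ∈ Set.range ρ := h ▸ Set.mem_range_self b
    exact this
  refine ⟨fun h0 => hπ.1 ?_, fun K hK hinv => hπ.2 K hK fun b ξ hξ => ?_⟩
  · ext1 b
    obtain ⟨c, hc⟩ := hmem b
    rw [← hc, h0]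
    rfl
  · obtain ⟨c, hc⟩ := hmem b
    rw [← hc]
    exact hinv c ξ hξ

lemma IsIrreducibleRep.of_comp {π : C →⋆ₙₐ[ℂ] (H →L[ℂ] H)} {ε : B →⋆ₙₐ[ℂ] C}
    (h : IsIrreducibleRep (π.comp ε)) (hε : Function.Surjective ε) : IsIrreducibleRep π :=
  h.of_range_eq (by rw [NonUnitalStarAlgHom.coe_comp, hε.range_comp])

lemma IsIrreducibleRep.comp {π : C →⋆ₙₐ[ℂ] (H →L[ℂ] H)} (h : IsIrreducibleRep π)
    {ε : B →⋆ₙₐ[ℂ] C} (hε : Function.Surjective ε) : IsIrreducibleRep (π.comp ε) :=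
  h.of_range_eq (by rw [NonUnitalStarAlgHom.coe_comp, hε.range_comp])

lemma IsIrreducibleRep.exists_ne_zero {π : B →⋆ₙₐ[ℂ] (H →L[ℂ] H)} (h : IsIrreducibleRep π) :
    ∃ b, π b ≠ 0 := by
  by_contra! h0
  exact h.1 (by ext1 b; exact h0 b)

/-- An irreducible representation either kills a right ideal or separates vectors with it. -/
lemma IsIrreducibleRep.forall_eq_zero_or {π : B →⋆ₙₐ[ℂ] (H →L[ℂ] H)} (hπ : IsIrreducibleRep π)
    {S : Set B} (hS : ∀ h ∈ S, ∀ b, h * b ∈ S) :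
    (∀ h ∈ S, π h = 0) ∨ ∀ ξ, (∀ h ∈ S, π h ξ = 0) → ξ = 0 := by
  -- The common kernel of `π h`, `h ∈ S`, is closed, and it is invariant because `S` absorbs
  -- multiplication on the right.
  let K : Submodule ℂ H := ⨅ h ∈ S, LinearMap.ker (π h : H →ₗ[ℂ] H)
  have hmem : ∀ ξ, ξ ∈ K ↔ ∀ h ∈ S, π h ξ = 0 := fun ξ => by simp [K]
  have hcl : IsClosed (K : Set H) := by
    have : (K : Set H) = ⋂ h ∈ S, {ξ | π h ξ = 0} := by
      ext ξ
      simp [hmem]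
    rw [this]
    exact isClosed_biInter fun h _ => isClosed_eq (π h).continuous continuous_const
  rcases hπ.2 K hcl fun b ξ hξ => (hmem _).2 fun h hh => by
    have := (hmem ξ).1 hξ (h * b) (hS h hh b)
    rwa [map_mul] at this with hK | hK
  · refine Or.inr fun ξ hξ => ?_
    rw [← Submodule.mem_bot ℂ, ← hK]
    exact (hmem ξ).2 hξ
  · refine Or.inl fun h hh => ?_
    ext ξ
    exact (hmem ξ).1 (hK ▸ Submodule.mem_top) h hh

/-- The kernel of an irreducible representation is prime. -/
lemma IsIrreducibleRep.exists_mul_ne_zero {π : B →⋆ₙₐ[ℂ] (H →L[ℂ] H)} (hπ : IsIrreducibleRep π)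
    {a b : B} (ha : π a ≠ 0) (hb : π b ≠ 0) : π (a * b) ≠ 0 ∨ ∃ c, π (a * c * b) ≠ 0 := by
  by_contra! h
  -- In the absence of a unit, `a` has to be adjoined to `aB`.
  rcases hπ.forall_eq_zero_or (S := {x | x = a ∨ ∃ c, x = a * c}) (by
    rintro x (rfl | ⟨c, rfl⟩) b
    · exact Or.inr ⟨b, rfl⟩
    · exact Or.inr ⟨c * b, mul_assoc _ _ _⟩) with h1 | h1
  · exact ha (h1 a (Or.inl rfl))
  · refine hb ?_
    ext ξ
    refine h1 _ ?_
    rintro x (rfl | ⟨c, rfl⟩)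
    · have := h.1
      rw [map_mul] at this
      exact DFunLike.congr_fun this ξ
    · have := h.2 c
      rw [map_mul] at this
      exact DFunLike.congr_fun this ξ

/-- A homomorphism that kills the kernel of a surjective homomorphism factors through it. -/
lemma exists_comp_eq_of_surjective {D : Type*} [NonUnitalCStarAlgebra D] {π : B →⋆ₙₐ[ℂ] D}
    {ε : B →⋆ₙₐ[ℂ] C} (hε : Function.Surjective ε) (h : ∀ b, ε b = 0 → π b = 0) :
    ∃ τ : C →⋆ₙₐ[ℂ] D, π = τ.comp ε := by
  have hwd : ∀ b b', ε b = ε b' → π b = π b' := fun b b' hb => by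
    rw [← sub_eq_zero, ← map_sub]
    exact h _ (by rw [map_sub, hb, sub_self])
  let s := Function.surjInv hε
  have hs : ∀ c, ε (s c) = c := Function.surjInv_eq hε
  refine ⟨{ toFun := fun c => π (s c)
            map_smul' := fun z c => ?_
            map_zero' := ?_
            map_add' := fun c d => ?_
            map_mul' := fun c d => ?_
            map_star' := fun c => ?_ }, ?_⟩
  · change _ = z • _
    rw [← map_smul]
    exact hwd _ _ (by rw [map_smul, hs, hs])
  · exact h _ (hs 0)
  · rw [← map_add]
    exact hwd _ _ (by rw [map_add, hs, hs, hs])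
  · rw [← map_mul]
    exact hwd _ _ (by rw [map_mul, hs, hs, hs])
  · rw [← map_star]
    exact hwd _ _ (by rw [map_star, hs, hs])
  · ext1 b
    exact hwd _ _ (hs _).symm

end Irreducible

/-! ## The section algebra -/

section SectionAlgebra

variable {X : Type u} [TopologicalSpace X] {A : X → Type w} [∀ x, NonUnitalCStarAlgebra (A x)]
  [TopologicalSpace (Tot A)] [IsUSCCStarBundle A]

/-- A family of elements of the fibres with bounded norms, as a bounded section. -/
def lpOfBound (f : ∀ x, A x) {C : ℝ} (hC : ∀ x, ‖f x‖ ≤ C) : lp A ∞ :=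
  ⟨f, memℓp_infty ⟨C, by rintro _ ⟨x, rfl⟩; exact hC x⟩⟩

lemma exists_mem_boundedSections_smul {f : lp A ∞} (hf : f ∈ boundedSections A) {φ : X → ℝ}
    (hφ : Continuous φ) (h01 : ∀ x, φ x ∈ Set.Icc (0 : ℝ) 1) :
    ∃ g ∈ boundedSections A, ∀ x, g x = (φ x : ℂ) • f x := by
  have hC : ∀ x, ‖(φ x : ℂ) • f x‖ ≤ ‖f‖ := fun x => by
    rw [norm_smul, Complex.norm_real, Real.norm_eq_abs, abs_of_nonneg (h01 x).1]
    refine (mul_le_of_le_one_left (norm_nonneg _) (h01 x).2).trans ?_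
    exact lp.norm_apply_le_norm ENNReal.top_ne_zero f x
  exact ⟨lpOfBound _ hC, continuous_section_smul hf hφ, fun x => rfl⟩

lemma exists_sectionAlgebra_smul (f : sectionAlgebra A) {φ : X → ℝ}
    (hφ : Continuous φ) (h01 : ∀ x, φ x ∈ Set.Icc (0 : ℝ) 1) :
    ∃ g : sectionAlgebra A, ∀ x, (g : lp A ∞) x = (φ x : ℂ) • (f : lp A ∞) x := by
  obtain ⟨g, hg, hgf⟩ := exists_mem_boundedSections_smul f.2.1 hφ h01
  refine ⟨⟨g, hg, ?_⟩, hgf⟩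
  refine squeeze_zero (fun _ => norm_nonneg _) (fun x => ?_) f.2.2
  rw [hgf, norm_smul, Complex.norm_real, Real.norm_eq_abs, abs_of_nonneg (h01 x).1]
  exact mul_le_of_le_one_left (norm_nonneg _) (h01 x).2

lemma exists_sectionAlgebra_smul_of_hasCompactSupport {f : lp A ∞} (hf : f ∈ boundedSections A)
    {φ : X → ℝ} (hφ : Continuous φ) (h01 : ∀ x, φ x ∈ Set.Icc (0 : ℝ) 1)
    (hc : HasCompactSupport φ) :
    ∃ g : sectionAlgebra A, ∀ x, (g : lp A ∞) x = (φ x : ℂ) • f x := by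
  obtain ⟨g, hg, hgf⟩ := exists_mem_boundedSections_smul hf hφ h01
  refine ⟨⟨g, hg, ?_⟩, hgf⟩
  refine tendsto_const_nhds.congr' ?_
  filter_upwards [hc.isCompact.compl_mem_cocompact] with x hx
  rw [hgf, image_eq_zero_of_notMem_tsupport hx]
  simp

lemma norm_sectionAlgebra_le {B : NonUnitalStarSubalgebra ℂ (lp A ∞)} (f : B) {C : ℝ} (hC : 0 ≤ C)
    (h : ∀ x, ‖(f : lp A ∞) x‖ ≤ C) : ‖f‖ ≤ C :=
  lp.norm_le_of_forall_le hC h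

/-- Upper semicontinuity of the norm makes the set closed, and vanishing at infinity puts it inside
a compact set. -/
lemma isCompact_setOf_le_norm (f : sectionAlgebra A) {ε : ℝ} (hε : 0 < ε) :
    IsCompact {x | ε ≤ ‖(f : lp A ∞) x‖} := by
  have hcl : IsClosed {x | ε ≤ ‖(f : lp A ∞) x‖} := by
    have := (upperSemicontinuous_norm_section f.2.1).isOpen_preimage ε
    convert! this.isClosed_compl using 1
    ext x
    simp
  have h0 : ∀ᶠ x in cocompact X, ‖(f : lp A ∞) x‖ < ε :=
    (show Tendsto _ _ _ from f.2.2).eventually_lt_const hε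
  obtain ⟨K, hK, hKs⟩ := mem_cocompact.1 h0
  refine hK.of_isClosed_subset hcl fun x hx => ?_
  by_contra hxK
  exact (not_lt.2 hx) (show ‖(f : lp A ∞) x‖ < ε from hKs hxK)

/-! ### Localisation of representations at points of the base -/

variable {H : Type t} [NormedAddCommGroup H] [InnerProductSpace ℂ H] [CompleteSpace H]

/-- The representation `π` kills the sections that vanish outside `V`. -/
def KillsOn (π : sectionAlgebra A →⋆ₙₐ[ℂ] (H →L[ℂ] H)) (V : Set X) : Prop :=
  ∀ f : sectionAlgebra A, (∀ x ∉ V, (f : lp A ∞) x = 0) → π f = 0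

/-- Sections supported in `V` form a right ideal whose products with sections supported in `W`
vanish. If this ideal is not killed, it separates vectors, so the sections supported in `W` act by
zero. -/
lemma IsIrreducibleRep.killsOn_or_killsOn {π : sectionAlgebra A →⋆ₙₐ[ℂ] (H →L[ℂ] H)}
    (hπ : IsIrreducibleRep π) {V W : Set X} (hVW : Disjoint V W) :
    KillsOn π V ∨ KillsOn π W := by
  rcases hπ.forall_eq_zero_or
    (S := {f : sectionAlgebra A | ∀ x ∉ V, (f : lp A ∞) x = 0}) (fun f hf b x hx => by
      change (f : lp A ∞) x * (b : lp A ∞) x = 0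
      rw [hf x hx, zero_mul]) with h | h
  · exact Or.inl h
  · refine Or.inr fun g hg => ?_
    ext ξ
    refine h _ fun f hf => ?_
    have hfg : f * g = 0 := by
      refine Subtype.ext (lp.ext (funext fun x => ?_))
      change (f : lp A ∞) x * (g : lp A ∞) x = 0
      by_cases hx : x ∈ V
      · rw [hg x (Set.disjoint_left.1 hVW hx), mul_zero]
      · rw [hf x hx, zero_mul]
    have := map_mul π f g
    rw [hfg, map_zero] at this
    exact (DFunLike.congr_fun this ξ).symm

variable [T2Space X] [LocallyCompactSpace X]

lemma exists_bump {x : X} {U : Set X} (hU : U ∈ 𝓝 x) :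
    ∃ φ : X → ℝ, Continuous φ ∧ (∀ y, φ y ∈ Set.Icc (0 : ℝ) 1) ∧ HasCompactSupport φ ∧
      φ x = 1 ∧ ∀ y ∉ U, φ y = 0 := by
  obtain ⟨φ, h1, h0, hc, h01⟩ := exists_continuous_one_zero_of_isCompact (isCompact_singleton (x := x))
    (isOpen_interior (s := U)).isClosed_compl (by
      rw [Set.disjoint_singleton_left]
      simpa using mem_interior_iff_mem_nhds.2 hU)
  exact ⟨φ, φ.continuous, h01, hc, h1 rfl, fun y hy => h0 fun h => hy (interior_subset h)⟩

variable [ParacompactSpace X]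

/-- Evaluation of the section algebra at a point is onto the fibre. -/
lemma evalAt_sectionAlgebra_surjective (x : X) :
    Function.Surjective (evalAt (sectionAlgebra A) x) := by
  intro a
  obtain ⟨f, hf, hfx, C, hC⟩ := exists_continuous_section x a
  obtain ⟨φ, hφ, h01, hc, h1, -⟩ := exists_bump (x := x) univ_mem
  obtain ⟨g, hg⟩ := exists_sectionAlgebra_smul_of_hasCompactSupport (f := lpOfBound f hC) hf
    hφ h01 hc
  refine ⟨g, ?_⟩
  change (g : lp A ∞) x = a
  rw [hg, h1, Complex.ofReal_one, one_smul]
  exact hfx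

/-- A partition of unity on `K` splits a section supported in `K` into finitely many sections, each
supported in a set on which `π` vanishes. -/
lemma killsOn_of_isCompact {π : sectionAlgebra A →⋆ₙₐ[ℂ] (H →L[ℂ] H)} {K : Set X}
    (hK : IsCompact K) (h : ∀ x ∈ K, ∃ V ∈ 𝓝 x, KillsOn π V) : KillsOn π K := by
  classical
  intro f hf
  choose! V hV hVk using h
  obtain ⟨T, hTK, hT⟩ := hK.elim_nhds_subcover (fun x => interior (V x))
    fun x hx => interior_mem_nhds.2 (hV x hx)
  obtain ⟨ρ, hρ⟩ := PartitionOfUnity.exists_isSubordinate hK.isClosed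
    (fun i : T => interior (V i.1)) (fun i => isOpen_interior) (by
      intro x hx
      obtain ⟨i, hi, hxi⟩ := Set.mem_iUnion₂.1 (hT hx)
      exact Set.mem_iUnion.2 ⟨⟨i, hi⟩, hxi⟩)
  have hg : ∀ i : T, ∃ g : sectionAlgebra A,
      ∀ x, (g : lp A ∞) x = (ρ i x : ℂ) • (f : lp A ∞) x := fun i =>
    exists_sectionAlgebra_smul f (ρ i).continuous fun x => ⟨ρ.nonneg i x, ρ.le_one i x⟩
  choose g hg using hg
  have hk : ∀ i, π (g i) = 0 := fun i => hVk i.1 (hTK i.1 i.2) _ fun x hx => by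
    rw [hg, image_eq_zero_of_notMem_tsupport fun h => hx (interior_subset (hρ i h))]
    simp
  have hsum : f = ∑ i, g i := by
    refine Subtype.ext (lp.ext (funext fun x => ?_))
    change (f : lp A ∞) x = evalAt (sectionAlgebra A) x (∑ i, g i)
    rw [map_sum]
    change _ = ∑ i, (g i : lp A ∞) x
    simp only [hg]
    by_cases hx : x ∈ K
    · have h1 := ρ.sum_eq_one hx
      rw [finsum_eq_sum_of_fintype] at h1
      rw [← Finset.sum_smul, ← Complex.ofReal_sum, h1]
      simp
    · simp [hf x hx]
  rw [hsum, map_sum]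
  exact Finset.sum_eq_zero fun i _ => hk i

/-- An irreducible representation of the section algebra lives over a single point. -/
lemma IsIrreducibleRep.exists_forall_evalAt_eq_zero {π : sectionAlgebra A →⋆ₙₐ[ℂ] (H →L[ℂ] H)}
    (hπ : IsIrreducibleRep π) :
    ∃ x : X, ∀ f, evalAt (sectionAlgebra A) x f = 0 → π f = 0 := by
  -- Of two distinct points, one has a neighbourhood whose sections are killed, so at most one point
  -- fails to have one. If none fails, any point serves.
  obtain ⟨x₀, hx₀⟩ : ∃ x₀ : X, ∀ x ≠ x₀, ∃ V ∈ 𝓝 x, KillsOn π V := by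
    by_cases h : ∃ x₀, ¬ ∃ V ∈ 𝓝 x₀, KillsOn π V
    · obtain ⟨x₀, hx₀⟩ := h
      refine ⟨x₀, fun x hx => ?_⟩
      obtain ⟨U, V, hU, hV, hxU, hxV, hUV⟩ := t2_separation hx
      rcases hπ.killsOn_or_killsOn hUV with h | h
      · exact ⟨U, hU.mem_nhds hxU, h⟩
      · exact absurd ⟨V, hV.mem_nhds hxV, h⟩ hx₀
    · push Not at h
      obtain ⟨f, hf⟩ := hπ.exists_ne_zero
      have : ∃ x, (f : lp A ∞) x ≠ 0 := by
        by_contra! h0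
        refine hf ?_
        have : f = 0 := Subtype.ext (lp.ext (funext h0))
        rw [this, map_zero]
      exact ⟨this.choose, fun x _ => h x⟩
  refine ⟨x₀, fun f hf => ?_⟩
  change (f : lp A ∞) x₀ = 0 at hf
  rw [← norm_le_zero_iff]
  refine le_of_forall_pos_le_add fun ε hε => ?_
  rw [zero_add]
  -- As `f x₀ = 0`, the set where `‖f‖ ≥ ε` avoids `x₀`. Cutting `f` off near this set gives a
  -- section that is killed and lies within `ε` of `f`.
  have hK := isCompact_setOf_le_norm f hε
  obtain ⟨O₁, O₂, hO₁, hO₂, hKO, hxO, hdisj⟩ :=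
    SeparatedNhds.of_isCompact_isCompact hK (isCompact_singleton (x := x₀)) (by
      rw [Set.disjoint_singleton_right]
      simpa [hf] using hε)
  obtain ⟨φ, h1, h0, hc, h01⟩ := exists_continuous_one_zero_of_isCompact hK hO₁.isClosed_compl
    (Set.disjoint_compl_right_iff_subset.2 hKO)
  obtain ⟨g, hg⟩ := exists_sectionAlgebra_smul f φ.continuous h01
  have hπg : π g = 0 := by
    refine killsOn_of_isCompact (hc.isCompact.inter_right hO₂.isClosed_compl)
      (fun x hx => hx₀ x ?_) g fun x hx => ?_
    · rintro rfl
      exact hx.2 (hxO rfl)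
    · have : φ x = 0 := by
        by_cases hxs : x ∈ tsupport φ
        · refine h0 fun hxO₁ => hx ⟨hxs, fun hxO₂ => ?_⟩
          exact Set.disjoint_left.1 hdisj hxO₁ hxO₂
        · exact image_eq_zero_of_notMem_tsupport hxs
      rw [hg, this]
      simp
  have hfg : ‖f - g‖ ≤ ε := by
    refine norm_sectionAlgebra_le _ hε.le fun x => ?_
    change ‖(f : lp A ∞) x - (g : lp A ∞) x‖ ≤ ε
    by_cases hx : x ∈ {x | ε ≤ ‖(f : lp A ∞) x‖}
    · have : φ x = 1 := h1 hx
      rw [hg, this]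
      simpa using hε.le
    · have h2 : (f : lp A ∞) x - (g : lp A ∞) x = ((1 - φ x : ℝ) : ℂ) • (f : lp A ∞) x := by
        rw [hg, Complex.ofReal_sub, sub_smul, Complex.ofReal_one, one_smul]
      rw [h2, norm_smul, Complex.norm_real, Real.norm_eq_abs,
        abs_of_nonneg (sub_nonneg.2 (h01 x).2)]
      refine (mul_le_of_le_one_left (norm_nonneg _) (by linarith [(h01 x).1])).trans ?_
      exact (not_le.1 hx).le
  have : π f = π (f - g) := by rw [map_sub, hπg, sub_zero]
  rw [this]
  exact (NonUnitalStarAlgHom.norm_apply_le π _).trans hfg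

/-- A nonzero representation of the section algebra lives over at most one point. -/
lemma eq_of_forall_evalAt_eq_zero {π : sectionAlgebra A →⋆ₙₐ[ℂ] (H →L[ℂ] H)} (h0 : π ≠ 0)
    {x y : X} (hx : ∀ f, evalAt (sectionAlgebra A) x f = 0 → π f = 0)
    (hy : ∀ f, evalAt (sectionAlgebra A) y f = 0 → π f = 0) : x = y := by
  by_contra hxy
  refine h0 ?_
  ext1 f
  -- With `φ x = 1` and `φ y = 0`, the summands of `f = (f - φ f) + φ f` vanish at `x` and at `y`
  -- respectively, so both are killed.
  obtain ⟨φ, hφ, h01, -, h1, hφy⟩ := exists_bump (isOpen_ne.mem_nhds hxy : {y}ᶜ ∈ 𝓝 x)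
  obtain ⟨g, hg⟩ := exists_sectionAlgebra_smul f hφ h01
  have hgx : π (f - g) = 0 := hx _ <| by
    change (f : lp A ∞) x - (g : lp A ∞) x = 0
    rw [hg, h1, Complex.ofReal_one, one_smul, sub_self]
  have hgy : π g = 0 := hy _ <| by
    change (g : lp A ∞) y = 0
    rw [hg, hφy y (by simp)]
    simp
  rwa [map_sub, hgy, sub_zero] at hgx

lemma IsIrreducibleRep.exists_eq_comp_evalAt {π : sectionAlgebra A →⋆ₙₐ[ℂ] (H →L[ℂ] H)}
    (hπ : IsIrreducibleRep π) :
    ∃ (x : X) (τ : A x →⋆ₙₐ[ℂ] (H →L[ℂ] H)), π = τ.comp (evalAt (sectionAlgebra A) x) := by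
  obtain ⟨x, hx⟩ := hπ.exists_forall_evalAt_eq_zero
  exact ⟨x, exists_comp_eq_of_surjective (evalAt_sectionAlgebra_surjective x) hx⟩

lemma comp_evalAt_injective {x : X} {τ σ : A x →⋆ₙₐ[ℂ] (H →L[ℂ] H)}
    (h : τ.comp (evalAt (sectionAlgebra A) x) = σ.comp (evalAt (sectionAlgebra A) x)) :
    τ = σ := by
  ext1 a
  obtain ⟨f, rfl⟩ := evalAt_sectionAlgebra_surjective x a
  exact DFunLike.congr_fun h f

end SectionAlgebra

/-! ## The topology of the spectrum -/

section SpectrumTopology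

lemma continuous_starAlgHom {B D : Type*} [NonUnitalCStarAlgebra B] [NonUnitalCStarAlgebra D]
    (π : B →⋆ₙₐ[ℂ] D) : Continuous π :=
  AddMonoidHomClass.continuous_of_bound π 1
    (by simpa only [one_mul] using NonUnitalStarAlgHom.norm_apply_le π)

/-- For `ε ≥ 0` and `b` there is an element killed by exactly those homomorphisms that map `b` to
an element of norm at most `ε`. -/
lemma exists_map_eq_zero_iff_norm_le {B : Type*} [NonUnitalCStarAlgebra B] (b : B) {ε : ℝ}
    (hε : 0 ≤ ε) : ∃ h : B, ∀ {D : Type v} [NonUnitalCStarAlgebra D] (π : B →⋆ₙₐ[ℂ] D),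
      π h = 0 ↔ ‖π b‖ ≤ ε := by
  -- Since `‖π b‖ ^ 2 = ‖π (star b * b)‖` and `π` commutes with the functional calculus, the witness
  -- is `f (star b * b)`. The absolute value in `f` lets norm bounds on the quasispectrum suffice,
  -- without positivity.
  let f : ℝ → ℝ := fun s => max (|s| - ε ^ 2) 0
  have hf : Continuous f := by fun_prop
  have hf0 : f 0 = 0 := by simp [f, sq_nonneg]
  have hfz : ∀ s, f s = 0 ↔ |s| ≤ ε ^ 2 := fun s => by simp [f]
  refine ⟨cfcₙ f (star b * b), fun {D} _ π => ?_⟩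
  have hsa : IsSelfAdjoint (star (π b) * π b) := IsSelfAdjoint.star_mul_self _
  have hmap : π (cfcₙ f (star b * b)) = cfcₙ f (star (π b) * π b) := by
    have h := NonUnitalStarAlgHom.map_cfcₙ (R := ℝ) π f (star b * b) hf.continuousOn hf0
      (continuous_starAlgHom π) (IsSelfAdjoint.star_mul_self _)
      (by rw [map_mul, map_star]; exact hsa)
    rw [h, map_mul, map_star]
  have hnorm : ‖star (π b) * π b‖ = ‖π b‖ ^ 2 := by rw [CStarRing.norm_star_mul_self, sq]
  rw [hmap, ← sq_le_sq₀ (norm_nonneg _) hε, ← hnorm]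
  constructor
  · intro h0
    have hspec : ∀ s ∈ quasispectrum ℝ (star (π b) * π b), ‖s‖ ≤ ε ^ 2 := by
      intro s hs
      have := norm_apply_le_norm_cfcₙ f (star (π b) * π b) hs hf.continuousOn hf0 hsa
      rw [h0, norm_zero, norm_le_zero_iff, hfz] at this
      exact this
    have := norm_cfcₙ_le (f := id) (a := star (π b) * π b) (c := ε ^ 2) hspec
    rwa [cfcₙ_id ℝ _ hsa] at this
  · intro hle
    rw [cfcₙ_congr (g := fun _ => 0), cfcₙ_const_zero]
    intro s hs
    rw [hfz]
    have := norm_apply_le_norm_cfcₙ id (star (π b) * π b) hs continuousOn_id rfl hsa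
    rw [cfcₙ_id ℝ _ hsa] at this
    exact this.trans hle

variable {B : Type w} [NonUnitalCStarAlgebra B]

lemma toSpectrum_eq_iff {π ρ : IrrRep.{w, t} B} :
    π.toSpectrum = ρ.toSpectrum ↔
      ∃ U : π.H ≃ₗᵢ[ℂ] ρ.H, ∀ b ξ, U (π.rep b ξ) = ρ.rep b (U ξ) :=
  Quotient.eq (r := unitaryEquiv.{w, t} B)

lemma toSpectrum_mk_eq_iff {H : Type t} [NormedAddCommGroup H] [InnerProductSpace ℂ H]
    [CompleteSpace H] {H' : Type t} [NormedAddCommGroup H'] [InnerProductSpace ℂ H']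
    [CompleteSpace H'] {π : B →⋆ₙₐ[ℂ] (H →L[ℂ] H)} {ρ : B →⋆ₙₐ[ℂ] (H' →L[ℂ] H')}
    (hπ : IsIrreducibleRep π) (hρ : IsIrreducibleRep ρ) :
    (IrrRep.mk H π hπ).toSpectrum = (IrrRep.mk H' ρ hρ).toSpectrum ↔
      ∃ U : H ≃ₗᵢ[ℂ] H', ∀ b ξ, U (π b ξ) = ρ b (U ξ) :=
  toSpectrum_eq_iff

lemma eq_zero_of_intertwiner {H : Type t} [NormedAddCommGroup H] [InnerProductSpace ℂ H]
    [CompleteSpace H] {H' : Type t} [NormedAddCommGroup H'] [InnerProductSpace ℂ H']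
    [CompleteSpace H'] {π : B →⋆ₙₐ[ℂ] (H →L[ℂ] H)} {ρ : B →⋆ₙₐ[ℂ] (H' →L[ℂ] H')}
    {U : H ≃ₗᵢ[ℂ] H'} (hU : ∀ b ξ, U (π b ξ) = ρ b (U ξ)) {b : B} (hb : ρ b = 0) : π b = 0 := by
  ext ξ
  apply U.injective
  rw [hU, hb]
  simp

lemma rep_ne_zero_of_toSpectrum_eq {π ρ : IrrRep.{w, t} B} (h : π.toSpectrum = ρ.toSpectrum)
    {b : B} (hb : π.rep b ≠ 0) : ρ.rep b ≠ 0 := by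
  obtain ⟨U, hU⟩ := toSpectrum_eq_iff.1 h
  exact fun h0 => hb (eq_zero_of_intertwiner hU h0)

/-- A set in the spectrum is open when each of its points is separated from the complement by an
element of the algebra. -/
lemma isOpen_spectrum_iff {V : Set (Spectrum.{w, t} B)} :
    IsOpen V ↔ ∀ π : IrrRep.{w, t} B, π.toSpectrum ∈ V →
      ∃ b, π.rep b ≠ 0 ∧ ∀ ρ : IrrRep.{w, t} B, ρ.toSpectrum ∉ V → ρ.rep b = 0 := by
  refine ⟨fun h => ?_, fun h => ?_⟩
  · induction h with
    | basic V hV =>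
      obtain ⟨J, -, -, rfl⟩ := hV
      rintro π ⟨π', hπ', b, hb, hne⟩
      refine ⟨b, rep_ne_zero_of_toSpectrum_eq hπ' hne, fun ρ hρ => ?_⟩
      by_contra h0
      exact hρ ⟨ρ, rfl, b, hb, h0⟩
    | univ =>
      intro π _
      obtain ⟨b, hb⟩ := π.irreducible.exists_ne_zero
      exact ⟨b, hb, fun ρ hρ => absurd (Set.mem_univ _) hρ⟩
    -- Primeness of the kernel of `π` makes a product `b * c` or `b * d * c` of the two witnesses
    -- survive in `π`; it is killed outside either set.
    | inter V W _ _ hV hW =>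
      intro π hπ
      obtain ⟨b, hb, hbV⟩ := hV π hπ.1
      obtain ⟨c, hc, hcW⟩ := hW π hπ.2
      have hz : ∀ d e (ρ : IrrRep.{w, t} B), ρ.toSpectrum ∉ V ∩ W →
          d ∈ ({x | ∀ ρ : IrrRep.{w, t} B, ρ.toSpectrum ∉ V → ρ.rep x = 0} : Set B) →
          e = c → ρ.rep (d * e) = 0 := by
        intro d e ρ hρ hd he
        rw [map_mul]
        by_cases hρV : ρ.toSpectrum ∈ V
        · rw [he, hcW ρ fun hρW => hρ ⟨hρV, hρW⟩, mul_zero]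
        · rw [hd ρ hρV, zero_mul]
      rcases π.irreducible.exists_mul_ne_zero hb hc with h | ⟨d, h⟩
      · exact ⟨b * c, h, fun ρ hρ => hz b c ρ hρ hbV rfl⟩
      · refine ⟨b * d * c, h, fun ρ hρ => hz (b * d) c ρ hρ (fun ρ' hρ' => ?_) rfl⟩
        rw [map_mul, hbV ρ' hρ', zero_mul]
    | sUnion S _ hS =>
      rintro π ⟨V, hV, hπ⟩
      obtain ⟨b, hb, hbV⟩ := hS V hV π hπ
      exact ⟨b, hb, fun ρ hρ => hbV ρ fun h => hρ ⟨V, hV, h⟩⟩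
  -- The ideal is the intersection of the kernels of all representations outside `V`.
  · refine TopologicalSpace.isOpen_generateFrom_of_mem ⟨⨅ ρ : {ρ : IrrRep.{w, t} B // ρ.toSpectrum ∉ V},
      LinearMap.ker (ρ.1.rep : B →ₗ[ℂ] (ρ.1.H →L[ℂ] ρ.1.H)), ?_, ?_, ?_⟩
    · simp only [Submodule.coe_iInf]
      exact isClosed_iInter fun ρ => isClosed_singleton.preimage (continuous_starAlgHom ρ.1.rep)
    · intro a b hb
      simp only [Submodule.mem_iInf, LinearMap.mem_ker] at hb ⊢
      have hb' : ∀ ρ : {ρ : IrrRep.{w, t} B // ρ.toSpectrum ∉ V}, ρ.1.rep b = 0 := hb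
      refine ⟨fun ρ => ?_, fun ρ => ?_⟩
      · change ρ.1.rep (a * b) = 0
        rw [map_mul, hb', mul_zero]
      · change ρ.1.rep (b * a) = 0
        rw [map_mul, hb', zero_mul]
    · ext p
      constructor
      · intro hp
        obtain ⟨π, rfl⟩ := Quotient.exists_rep p
        obtain ⟨b, hb, hbV⟩ := h π hp
        exact ⟨π, rfl, b, (Submodule.mem_iInf _).2 fun ρ => hbV ρ.1 ρ.2, hb⟩
      · rintro ⟨π, rfl, b, hb, hne⟩
        by_contra hp
        exact hne ((Submodule.mem_iInf _).1 hb ⟨π, hp⟩)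

end SpectrumTopology

/-! ## The topology of a principal and proper groupoid and of its orbit space -/

section GroupoidTopology

variable {X : Type u} [Groupoid.{v} X] [TopologicalSpace X] [TopologicalSpace (Arrows X)]

/-! ### The unit space of a topological groupoid -/

section Basic

variable [IsTopologicalGroupoid X]

variable (X) in
-- The identity at the source is the product of `γ` with its inverse, and units are embedded in the
-- arrows.
lemma continuous_source : Continuous (fun γ : Arrows X => γ.left) := by
  rw [(IsTopologicalGroupoid.isEmbedding_unit (X := X)).continuous_iff]
  have h := (IsTopologicalGroupoid.continuous_comp (X := X)).comp
    (f := fun γ : Arrows X => (⟨γ.hom, Groupoid.inv γ.hom⟩ : ComposablePair X))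
    (continuous_induced_rng.2
      (continuous_id.prodMk (IsTopologicalGroupoid.continuous_inv (X := X))))
  refine h.congr fun γ => ?_
  simp

variable (X) in
lemma continuous_range : Continuous (fun γ : Arrows X => γ.right) :=
  (continuous_source X).comp (IsTopologicalGroupoid.continuous_inv (X := X))

variable (X) in
lemma continuous_unit : Continuous (fun x : X => (⟨x, x, 𝟙 x⟩ : Arrows X)) :=
  (IsTopologicalGroupoid.isEmbedding_unit (X := X)).continuous

variable (X) in
lemma t2Space_unitSpace [T2Space (Arrows X)] : T2Space X :=
  (IsTopologicalGroupoid.isEmbedding_unit (X := X)).t2Space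

variable (X) in
lemma secondCountableTopology_unitSpace [SecondCountableTopology (Arrows X)] :
    SecondCountableTopology X :=
  (IsTopologicalGroupoid.isEmbedding_unit (X := X)).secondCountableTopology

variable (X) in
-- The units are the fixed points of the continuous map sending `γ` to the identity at its source,
-- hence a closed subset of the Hausdorff arrow space.
lemma locallyCompactSpace_unitSpace [T2Space (Arrows X)] [LocallyCompactSpace (Arrows X)] :
    LocallyCompactSpace X := by
  refine IsClosedEmbedding.locallyCompactSpace
    (f := fun x : X => (⟨x, x, 𝟙 x⟩ : Arrows X))
    ⟨IsTopologicalGroupoid.isEmbedding_unit, ?_⟩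
  have : Set.range (fun x : X => (⟨x, x, 𝟙 x⟩ : Arrows X)) =
      {γ | (⟨γ.left, γ.left, 𝟙 γ.left⟩ : Arrows X) = γ} := by
    ext γ
    constructor
    · rintro ⟨x, rfl⟩
      rfl
    · intro h
      exact ⟨γ.left, h⟩
  rw [this]
  exact isClosed_eq ((continuous_unit X).comp (continuous_source X)) continuous_id

end Basic

/-! ### Openness of range and source -/

section Haar

variable [MeasurableSpace (Arrows X)] [BorelSpace (Arrows X)] [T2Space (Arrows X)]
  [LocallyCompactSpace (Arrows X)] [SecondCountableTopology (Arrows X)]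

/-- The range map of a groupoid with a Haar system is open. -/
lemma HaarSystem.isOpenMap_range (haar : HaarSystem X) :
    IsOpenMap (fun γ : Arrows X => γ.right) := by
  rw [isOpenMap_iff_nhds_le]
  intro γ₀ S hS
  have hS' : (fun γ : Arrows X => γ.right) ⁻¹' S ∈ 𝓝 γ₀ := hS
  -- The integral of this bump against the measure at `x` is continuous in `x` and positive at the
  -- range of `γ₀`, which lies in the support of its measure. It vanishes when `x ∉ S`, so `S`
  -- contains a neighbourhood of that range.
  obtain ⟨φ, h1, h0, hc, h01⟩ := exists_continuous_one_zero_of_isCompact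
    (isCompact_singleton (x := γ₀)) (isOpen_interior
      (s := (fun γ : Arrows X => γ.right) ⁻¹' S)).isClosed_compl (by
        rw [Set.disjoint_singleton_left, Set.mem_compl_iff, not_not]
        exact mem_interior_iff_mem_nhds.2 hS')
  have hfc := haar.finite_on_compacts
  have hcont := haar.continuous_integral (fun γ => (φ γ : ℂ))
    (Complex.continuous_ofReal.comp φ.continuous)
    (hc.comp_left (g := fun s : ℝ => (s : ℂ)) Complex.ofReal_zero)
  have hpos : ∫ γ, (φ γ : ℂ) ∂(haar.measure γ₀.right) ≠ 0 := by
    rw [integral_complex_ofReal, Complex.ofReal_ne_zero]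
    refine ne_of_gt ?_
    rw [integral_pos_iff_support_of_nonneg (fun γ => (h01 γ).1)
      (φ.continuous.integrable_of_hasCompactSupport hc)]
    have hmem : γ₀ ∈ (haar.measure γ₀.right).support := by
      rw [haar.support_eq]
      rfl
    refine (Measure.mem_support_iff_forall γ₀).1 hmem _ ?_
    refine φ.continuous.continuousAt.eventually_ne ?_
    rw [h1 rfl]
    exact one_ne_zero
  filter_upwards [hcont.continuousAt.eventually_ne hpos] with x hx
  by_contra hxS
  refine hx (integral_eq_zero_of_ae ?_)
  filter_upwards [Measure.support_mem_ae (μ := haar.measure x)] with γ hγ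
  rw [haar.support_eq] at hγ
  have : φ γ = 0 := h0 fun h => hxS (by
    have h' := interior_subset h
    change γ.right ∈ S at h'
    rwa [show γ.right = x from hγ] at h')
  simp [this]

lemma HaarSystem.isOpenMap_source [IsTopologicalGroupoid X] (haar : HaarSystem X) :
    IsOpenMap (fun γ : Arrows X => γ.left) := by
  intro U hU
  have h := haar.isOpenMap_range _ (hU.preimage (IsTopologicalGroupoid.continuous_inv (X := X)))
  convert! h using 1
  ext x
  constructor
  · rintro ⟨γ, hγ, rfl⟩
    exact ⟨⟨_, _, Groupoid.inv γ.hom⟩, by simpa using hγ, rfl⟩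
  · rintro ⟨γ, hγ, rfl⟩
    exact ⟨_, hγ, rfl⟩

end Haar

/-! ### The orbit space, and arrows near units -/

section Orbits

variable [IsTopologicalGroupoid X]

/-- The saturation of `U` is the set of ranges of arrows with source in `U`. -/
lemma isOpenMap_mk_orbit (hopen : IsOpenMap (fun γ : Arrows X => γ.right)) :
    IsOpenMap (Quotient.mk (orbitSetoid X)) := by
  intro U hU
  change IsOpen (Quotient.mk (orbitSetoid X) ⁻¹' (Quotient.mk (orbitSetoid X) '' U))
  convert! hopen _ (hU.preimage (continuous_source X)) using 1
  ext y
  constructor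
  · rintro ⟨x, hx, hxy⟩
    obtain ⟨γ⟩ : Nonempty (x ⟶ y) := Quotient.exact hxy
    exact ⟨⟨x, y, γ⟩, hx, rfl⟩
  · rintro ⟨γ, hγ, rfl⟩
    exact ⟨γ.left, hγ, Quotient.sound ⟨γ.hom⟩⟩

lemma isOpenQuotientMap_mk_orbit (hopen : IsOpenMap (fun γ : Arrows X => γ.right)) :
    IsOpenQuotientMap (Quotient.mk (orbitSetoid X)) :=
  ⟨Quotient.mk_surjective, continuous_quotient_mk', isOpenMap_mk_orbit hopen⟩

variable [T2Space (Arrows X)] [LocallyCompactSpace (Arrows X)]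

lemma IsProperGroupoid.isProperMap (hproper : IsProperGroupoid X) :
    IsProperMap (fun γ : Arrows X => (γ.left, γ.right)) := by
  have := t2Space_unitSpace X
  have := locallyCompactSpace_unitSpace X
  have hcont := (continuous_source X).prodMk (continuous_range X)
  refine isProperMap_iff_isCompact_preimage.2 ⟨hcont, fun K hK => ?_⟩
  refine (hproper _ _ (hK.image continuous_fst) (hK.image continuous_snd)).of_isClosed_subset
    (hK.isClosed.preimage hcont) fun γ hγ => ⟨⟨_, hγ, rfl⟩, ⟨_, hγ, rfl⟩⟩

/-- The orbit relation is the range of the proper map (source, range), hence closed; for an open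
quotient map this is equivalent to a Hausdorff quotient. -/
lemma t2Space_unitOrbits (hproper : IsProperGroupoid X)
    (hopen : IsOpenMap (fun γ : Arrows X => γ.right)) : T2Space (UnitOrbits X) := by
  rw [t2Space_iff_of_isOpenQuotientMap (isOpenQuotientMap_mk_orbit hopen)]
  convert! hproper.isProperMap.isClosedMap.isClosed_range using 1
  ext ⟨x, y⟩
  constructor
  · intro h
    obtain ⟨γ⟩ : Nonempty (x ⟶ y) := Quotient.exact h
    exact ⟨⟨x, y, γ⟩, rfl⟩
  · rintro ⟨γ, hγ⟩
    obtain ⟨rfl, rfl⟩ := Prod.mk.inj hγ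
    exact Quotient.sound ⟨γ.hom⟩

lemma locallyCompactSpace_unitOrbits (hopen : IsOpenMap (fun γ : Arrows X => γ.right)) :
    LocallyCompactSpace (UnitOrbits X) := by
  have := locallyCompactSpace_unitSpace X
  exact (isOpenQuotientMap_mk_orbit hopen).locallyCompactSpace

lemma secondCountableTopology_unitOrbits [SecondCountableTopology (Arrows X)]
    (hopen : IsOpenMap (fun γ : Arrows X => γ.right)) :
    SecondCountableTopology (UnitOrbits X) := by
  have := secondCountableTopology_unitSpace X
  exact (isOpenQuotientMap_mk_orbit hopen).isQuotientMap.secondCountableTopology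
    (isOpenMap_mk_orbit hopen)

/-- In a principal and proper groupoid, arrows whose source and range are close to a unit are close
to that unit. -/
lemma exists_nhds_forall_arrow_mem (hprincipal : IsPrincipal X) (hproper : IsProperGroupoid X)
    {x : X} {N : Set (Arrows X)} (hN : N ∈ 𝓝 (⟨x, x, 𝟙 x⟩ : Arrows X)) :
    ∃ P ∈ 𝓝 x, ∀ {y z : X} (γ : y ⟶ z), y ∈ P → z ∈ P → (⟨y, z, γ⟩ : Arrows X) ∈ N := by
  -- The image of the arrows outside the interior of `N` is closed. It misses `(x, x)`, as the only
  -- arrow from `x` to itself is the unit.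
  have hcl := hproper.isProperMap.isClosedMap _ (isOpen_interior (s := N)).isClosed_compl
  have hmem : (x, x) ∉ (fun γ : Arrows X => (γ.left, γ.right)) '' (interior N)ᶜ := by
    rintro ⟨⟨y, z, γ⟩, hγ, h⟩
    obtain ⟨h1, h2⟩ := Prod.mk.inj h
    change y = x at h1
    change z = x at h2
    subst h1 h2
    obtain rfl := hprincipal _ γ
    exact hγ (mem_interior_iff_mem_nhds.2 hN)
  have hnh := hcl.isOpen_compl.mem_nhds hmem
  rw [nhds_prod_eq, mem_prod_iff] at hnh
  obtain ⟨P, hP, Q, hQ, hPQ⟩ := hnh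
  refine ⟨P ∩ Q, inter_mem hP hQ, fun {y z} γ hy hz => ?_⟩
  by_contra hγ
  exact hPQ (Set.mk_mem_prod hy.1 hz.2) ⟨⟨y, z, γ⟩, fun h => hγ (interior_subset h), rfl⟩

end Orbits

end GroupoidTopology

/-! ## The quotient bundle of a bundle by a principal and proper groupoid -/

section OrbitBundle

variable {X : Type u} [Groupoid.{v} X]

lemma IsPrincipal.arrow_eq (hprincipal : IsPrincipal X) {x y : X} (γ η : x ⟶ y) : γ = η := by
  have h := hprincipal x (γ ≫ Groupoid.inv η)
  calc γ = (γ ≫ Groupoid.inv η) ≫ η := by simp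
    _ = η := by rw [h, Category.id_comp]

/-- An arrow from a unit to the chosen representative of its orbit. -/
def toOut (x : X) : x ⟶ (Quotient.mk (orbitSetoid X) x).out :=
  Groupoid.inv (Classical.choice (Quotient.mk_out (s := orbitSetoid X) x))

variable [TopologicalSpace (Arrows X)] {A : X → Type w} [∀ x, NonUnitalCStarAlgebra (A x)] [TopologicalSpace (Tot A)]

/-- Unitality is not among the axioms: the map of an identity arrow is idempotent and injective. -/
lemma BundleAction.map_id (α : BundleAction A) {x : X} (a : A x) : α.map (𝟙 x) a = a := by
  have h := α.map_comp (𝟙 x) (𝟙 x) a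
  rw [Category.comp_id] at h
  exact ((α.map (𝟙 x)).injective h).symm

lemma BundleAction.norm_map (α : BundleAction A) {x y : X} (γ : x ⟶ y) (a : A x) :
    ‖α.map γ a‖ = ‖a‖ :=
  StarAlgEquiv.norm_map (α.map γ) a

lemma BundleAction.map_inv_map (α : BundleAction A) {x y : X} (γ : x ⟶ y) (a : A x) :
    α.map (Groupoid.inv γ) (α.map γ a) = a := by
  rw [← α.map_comp, Groupoid.comp_inv, α.map_id]

lemma BundleAction.map_map_inv (α : BundleAction A) {x y : X} (γ : x ⟶ y) (a : A y) :
    α.map γ (α.map (Groupoid.inv γ) a) = a := by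
  rw [← α.map_comp, Groupoid.inv_comp, α.map_id]

lemma BundleAction.invMap_eq (α : BundleAction A) {x y : X} (γ : x ⟶ y) (a : A y) :
    α.invMap γ a = α.map (Groupoid.inv γ) a := by
  change (α.map γ).symm a = _
  rw [← EquivLike.coe_coe, ← Equiv.apply_eq_iff_eq (EquivLike.toEquiv (α.map γ))]
  exact ((α.map γ).toRingEquiv.toEquiv.apply_symm_apply a).trans (α.map_map_inv γ a).symm

/-- The fibre of the quotient bundle over an orbit: the fibre of the given bundle over a
representative. -/
def OrbitFibre (_α : BundleAction A) (o : UnitOrbits X) : Type w := A o.out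

instance (α : BundleAction A) (o : UnitOrbits X) : NonUnitalCStarAlgebra (OrbitFibre α o) :=
  inferInstanceAs (NonUnitalCStarAlgebra (A o.out))

variable (α : BundleAction A)

/-- The quotient map from a bundle to the quotient bundle. -/
def orbitMap (z : Tot A) : Tot (OrbitFibre α) :=
  ⟨Quotient.mk _ z.proj, (α.map (toOut z.proj) z.snd : A (Quotient.mk _ z.proj).out)⟩

/-- The quotient bundle carries the quotient topology. -/
instance : TopologicalSpace (Tot (OrbitFibre α)) :=
  TopologicalSpace.coinduced (orbitMap α) inferInstance

lemma continuous_orbitMap : Continuous (orbitMap α) := continuous_coinduced_rng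

variable {α}

lemma BundleAction.exists_nhds_map_mem {x y : X} {γ : x ⟶ y} {a : A x} {W : Set (Tot A)}
    (hW : W ∈ 𝓝 (⟨y, α.map γ a⟩ : Tot A)) :
    ∃ N ∈ 𝓝 (⟨x, y, γ⟩ : Arrows X), ∃ M ∈ 𝓝 (⟨x, a⟩ : Tot A), ∀ {x' y' : X} (η : x' ⟶ y')
      (b : A x'), (⟨x', y', η⟩ : Arrows X) ∈ N → (⟨x', b⟩ : Tot A) ∈ M →
        (⟨y', α.map η b⟩ : Tot A) ∈ W := by
  have h := α.continuous_map.continuousAt (x := ⟨γ, a⟩) hW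
  rw [mem_map, nhds_induced, mem_comap] at h
  obtain ⟨S, hS, hSW⟩ := h
  rw [nhds_prod_eq, mem_prod_iff] at hS
  obtain ⟨N, hN, M, hM, hNM⟩ := hS
  refine ⟨N, hN, M, hM, fun {x' y'} η b hη hb => ?_⟩
  have : (⟨η, b⟩ : ArrowPair A) ∈ (fun p : ArrowPair A => (⟨p.tgt, α.map p.hom p.val⟩ : Tot A)) ⁻¹' W :=
    hSW (hNM (Set.mk_mem_prod hη hb))
  exact this

/-- Uniqueness of arrows allows any arrow to the representative in place of the chosen `toOut`, so
the choice plays no further role. -/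
lemma orbitMap_eq_mk_iff (hprincipal : IsPrincipal X) {x : X} {a : A x} {o : UnitOrbits X}
    {c : A o.out} : orbitMap α ⟨x, a⟩ = ⟨o, c⟩ ↔ ∃ γ : x ⟶ o.out, α.map γ a = c := by
  constructor
  · intro h
    have h1 : Quotient.mk (orbitSetoid X) x = o := congrArg Bundle.TotalSpace.proj h
    subst h1
    exact ⟨toOut x, eq_of_heq (Bundle.TotalSpace.mk.inj h).2⟩
  · rintro ⟨γ, rfl⟩
    obtain rfl : Quotient.mk (orbitSetoid X) x = o := by
      rw [← Quotient.out_eq o]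
      exact Quotient.sound ⟨γ⟩
    rw [hprincipal.arrow_eq γ (toOut x)]
    rfl

lemma orbitMap_out (hprincipal : IsPrincipal X) (o : UnitOrbits X) (c : OrbitFibre α o) :
    orbitMap α ⟨o.out, c⟩ = ⟨o, c⟩ :=
  (orbitMap_eq_mk_iff hprincipal).2 ⟨𝟙 _, α.map_id (show A o.out from c)⟩

lemma orbitMap_eq_iff (hprincipal : IsPrincipal X) {x y : X} {a : A x} {b : A y} :
    orbitMap α ⟨x, a⟩ = orbitMap α ⟨y, b⟩ ↔ ∃ γ : x ⟶ y, α.map γ a = b := by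
  have h : orbitMap α ⟨y, b⟩ = ⟨Quotient.mk _ y, (α.map (toOut y) b : A (Quotient.mk _ y).out)⟩ :=
    rfl
  rw [h, orbitMap_eq_mk_iff hprincipal]
  constructor
  · rintro ⟨γ, hγ⟩
    exact ⟨γ ≫ Groupoid.inv (toOut y), by rw [α.map_comp, hγ, α.map_inv_map]⟩
  · rintro ⟨γ, rfl⟩
    exact ⟨γ ≫ toOut y, α.map_comp _ _ _⟩

lemma norm_orbitMap (z : Tot A) : ‖(orbitMap α z).snd‖ = ‖z.snd‖ :=
  α.norm_map (toOut z.proj) z.snd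

/-- An operation on pairs in the same fibre passes to the quotient bundle. -/
lemma orbitMap_op (hprincipal : IsPrincipal X) {op : ∀ {x}, A x → A x → A x}
    (hop : ∀ {x y : X} (γ : x ⟶ y) (a b : A x), α.map γ (op a b) = op (α.map γ a) (α.map γ b))
    {x : X} {a b : A x} {o : UnitOrbits X} {c d : A o.out} (hac : orbitMap α ⟨x, a⟩ = ⟨o, c⟩)
    (hbd : orbitMap α ⟨x, b⟩ = ⟨o, d⟩) : orbitMap α ⟨x, op a b⟩ = ⟨o, op c d⟩ := by
  obtain ⟨γ, rfl⟩ := (orbitMap_eq_mk_iff hprincipal).1 hac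
  obtain ⟨η, rfl⟩ := (orbitMap_eq_mk_iff hprincipal).1 hbd
  obtain rfl := hprincipal.arrow_eq γ η
  exact (orbitMap_eq_mk_iff hprincipal).2 ⟨γ, hop γ a b⟩

variable [TopologicalSpace X]

/-- If `γ` carries `(y, b)` into the open set `O`, openness of the source provides, for every `y'`
near `y`, an arrow near `γ` starting at `y'`. By continuity of the action it carries points near
`(y, b)` into `O`, so the saturation of `O` is open. -/
lemma isOpenQuotientMap_orbitMap (hprincipal : IsPrincipal X)
    (hopen : IsOpenMap (fun γ : Arrows X => γ.left)) [IsUSCCStarBundle A] :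
    IsOpenQuotientMap (orbitMap α) := by
  refine ⟨fun ⟨o, c⟩ => ⟨⟨o.out, c⟩, orbitMap_out hprincipal o c⟩, continuous_orbitMap α,
    fun O hO => ?_⟩
  change IsOpen (orbitMap α ⁻¹' (orbitMap α '' O))
  rw [isOpen_iff_mem_nhds]
  rintro ⟨y, b⟩ ⟨⟨x, a⟩, haO, hq⟩
  obtain ⟨γ, rfl⟩ := (orbitMap_eq_iff hprincipal).1 hq.symm
  obtain ⟨N, hN, M, hM, hNM⟩ := BundleAction.exists_nhds_map_mem (hO.mem_nhds haO)
  filter_upwards [hM, (tendsto_proj (⟨y, b⟩ : Tot A)).eventually (hopen.image_mem_nhds hN)]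
    with ⟨y', b'⟩ hb' ⟨⟨y'', x', γ'⟩, hγ', h⟩
  obtain rfl : y'' = y' := h
  exact ⟨_, hNM γ' b' hγ' hb', (orbitMap_eq_iff hprincipal).2 ⟨Groupoid.inv γ', α.map_inv_map γ' b'⟩⟩

variable [IsTopologicalGroupoid X] [T2Space (Arrows X)] [LocallyCompactSpace (Arrows X)]
  [IsUSCCStarBundle A]

/-- The action moves points little along arrows with nearby source and range. -/
lemma exists_nhds_forall_map_mem (hprincipal : IsPrincipal X) (hproper : IsProperGroupoid X)
    {x : X} {a : A x} {W : Set (Tot A)} (hW : W ∈ 𝓝 (⟨x, a⟩ : Tot A)) :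
    ∃ M ∈ 𝓝 (⟨x, a⟩ : Tot A), ∃ P ∈ 𝓝 x, ∀ {y z : X} (γ : y ⟶ z) (b : A y),
      (⟨y, b⟩ : Tot A) ∈ M → z ∈ P → (⟨z, α.map γ b⟩ : Tot A) ∈ W := by
  rw [← α.map_id a] at hW
  obtain ⟨N, hN, M, hM, hNM⟩ := BundleAction.exists_nhds_map_mem hW
  obtain ⟨P, hP, hPN⟩ := exists_nhds_forall_arrow_mem hprincipal hproper hN
  exact ⟨_, inter_mem hM (tendsto_proj (⟨x, a⟩ : Tot A) hP), P, hP, fun γ b hb hz =>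
    hNM γ b (hPN γ hb.2 hz) hb.1⟩

/-- Two nearby points of one quotient fibre lift to points over different units `y` and `z` of the
same orbit, where the operation makes no sense. Moving one along the arrow from `z` to `y` brings
them into one fibre, and `exists_nhds_forall_map_mem` keeps it near its limit. -/
lemma continuous_orbitFibre_op (hprincipal : IsPrincipal X) (hproper : IsProperGroupoid X)
    (hopen : IsOpenMap (fun γ : Arrows X => γ.left)) {op : ∀ {x}, A x → A x → A x}
    (hop : ∀ {x y : X} (γ : x ⟶ y) (a b : A x), α.map γ (op a b) = op (α.map γ a) (α.map γ b))
    (hcont : Continuous (fun p : FibrePair A => (⟨p.base, op p.fst p.snd⟩ : Tot A)))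
    {op' : ∀ o, OrbitFibre α o → OrbitFibre α o → OrbitFibre α o}
    (hop' : ∀ (o : UnitOrbits X) (a b : A o.out), op' o a b = op a b) :
    Continuous (fun p : FibrePair (OrbitFibre α) =>
      (⟨p.base, op' p.base p.fst p.snd⟩ : Tot (OrbitFibre α))) := by
  have hq := isOpenQuotientMap_orbitMap (α := α) hprincipal hopen
  suffices h : ∀ (o : UnitOrbits X) (a b : A o.out), ContinuousAt
      (fun p : FibrePair (OrbitFibre α) => (⟨p.base, op' p.base p.fst p.snd⟩ : Tot (OrbitFibre α)))
      ⟨o, a, b⟩ from continuous_iff_continuousAt.2 fun ⟨o, a, b⟩ => h o a b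
  intro o a b W hW
  have he : orbitMap α ⟨o.out, op a b⟩ = ⟨o, op' o a b⟩ :=
    (orbitMap_eq_mk_iff hprincipal).2 ⟨𝟙 _, (α.map_id _).trans (hop' o a b).symm⟩
  have hW' : orbitMap α ⁻¹' W ∈ 𝓝 (⟨o.out, op a b⟩ : Tot A) := by
    refine hq.continuous.continuousAt.preimage_mem_nhds ?_
    rw [he]
    exact hW
  obtain ⟨U, hU, V, hV, hUV⟩ := exists_nhds_of_fibrePair
    (hcont.continuousAt (x := ⟨o.out, a, b⟩) hW')
  obtain ⟨M, hM, P, hP, hMP⟩ := exists_nhds_forall_map_mem (α := α) hprincipal hproper hV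
  have hU' := hq.isOpenMap.image_mem_nhds
    (inter_mem hU (tendsto_proj (⟨o.out, a⟩ : Tot A) hP))
  have hM' := hq.isOpenMap.image_mem_nhds hM
  have hoa : orbitMap α ⟨o.out, a⟩ = ⟨o, a⟩ := orbitMap_out hprincipal o a
  have hob : orbitMap α ⟨o.out, b⟩ = ⟨o, b⟩ := orbitMap_out hprincipal o b
  dsimp only at hU' hM'
  rw [hoa] at hU'
  rw [hob] at hM'
  rw [mem_map, nhds_induced, mem_comap]
  refine ⟨_, prod_mem_nhds hU' hM', ?_⟩
  rintro ⟨o', a', b'⟩ ⟨⟨⟨y, a₁⟩, ⟨haU, haP⟩, ha⟩, ⟨⟨z, b₁⟩, hbM, hb⟩⟩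
  obtain ⟨γ, hγ⟩ := (orbitMap_eq_mk_iff hprincipal).1 ha
  obtain ⟨η, hη⟩ := (orbitMap_eq_mk_iff hprincipal).1 hb
  have h1 := hMP (η ≫ Groupoid.inv γ) b₁ hbM haP
  have h2 := hUV y a₁ _ haU h1
  change orbitMap α _ ∈ W at h2
  have h3 : orbitMap α ⟨y, α.map (η ≫ Groupoid.inv γ) b₁⟩ = ⟨o', b'⟩ :=
    ((orbitMap_eq_iff hprincipal).2 ⟨γ ≫ Groupoid.inv η, by
      rw [← α.map_comp]
      simp [α.map_id]⟩).trans hb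
  rw [orbitMap_op hprincipal hop ha h3] at h2
  have h4 := hop' o' a' b'
  change (⟨o', op' o' a' b'⟩ : Tot (OrbitFibre α)) ∈ W
  rw [h4]
  exact h2

/-- The quotient of an upper semicontinuous `C*`-bundle by a principal and proper groupoid with
open source map is an upper semicontinuous `C*`-bundle over the orbit space. -/
lemma isUSCCStarBundle_orbitFibre (hprincipal : IsPrincipal X) (hproper : IsProperGroupoid X)
    (hl : IsOpenMap (fun γ : Arrows X => γ.left)) (hr : IsOpenMap (fun γ : Arrows X => γ.right)) :
    IsUSCCStarBundle (OrbitFibre α) where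
  continuous_proj := by
    rw [← (isOpenQuotientMap_orbitMap (α := α) hprincipal hl).continuous_comp_iff]
    exact continuous_quotient_mk'.comp (IsUSCCStarBundle.continuous_proj (A := A))
  isOpenMap_proj := by
    rw [(isOpenQuotientMap_orbitMap (α := α) hprincipal hl).isOpenMap_iff]
    exact (isOpenMap_mk_orbit hr).comp (IsUSCCStarBundle.isOpenMap_proj (A := A))
  usc_norm := by
    have hq := isOpenQuotientMap_orbitMap (α := α) hprincipal hl
    intro z c hz
    obtain ⟨z, rfl⟩ := hq.surjective z
    rw [← hq.map_nhds_eq, eventually_map]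
    simp only [norm_orbitMap] at hz ⊢
    exact IsUSCCStarBundle.usc_norm (A := A) z c hz
  continuous_add := continuous_orbitFibre_op hprincipal hproper hl
    (op := fun a b => a + b) (fun γ a b => map_add (α.map γ) a b)
    (IsUSCCStarBundle.continuous_add (A := A)) (op' := fun _ a b => a + b) (fun _ _ _ => rfl)
  continuous_mul := continuous_orbitFibre_op hprincipal hproper hl
    (op := fun a b => a * b) (fun γ a b => map_mul (α.map γ) a b)
    (IsUSCCStarBundle.continuous_mul (A := A)) (op' := fun _ a b => a * b) (fun _ _ _ => rfl)
  continuous_smul c := by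
    have hq := isOpenQuotientMap_orbitMap (α := α) hprincipal hl
    rw [← hq.continuous_comp_iff]
    refine (hq.continuous.comp (IsUSCCStarBundle.continuous_smul (A := A) c)).congr fun z => ?_
    exact (orbitMap_eq_mk_iff hprincipal).2 ⟨toOut z.proj, map_smul (α.map (toOut z.proj)) c z.snd⟩
  continuous_star := by
    have hq := isOpenQuotientMap_orbitMap (α := α) hprincipal hl
    rw [← hq.continuous_comp_iff]
    refine (hq.continuous.comp (IsUSCCStarBundle.continuous_star (A := A))).congr fun z => ?_
    exact (orbitMap_eq_mk_iff hprincipal).2 ⟨toOut z.proj, map_star (α.map (toOut z.proj)) z.snd⟩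
  tendsto_zero o := by
    intro W hW
    have hW' : orbitMap α ⁻¹' W ∈ 𝓝 (⟨o.out, 0⟩ : Tot A) := by
      refine (continuous_orbitMap α).continuousAt.preimage_mem_nhds ?_
      rw [show orbitMap α ⟨o.out, 0⟩ = ⟨o, 0⟩ from orbitMap_out hprincipal o 0]
      exact hW
    obtain ⟨U, hU, δ, hδ, P, hP, hUP⟩ := exists_add_mem_of_norm_lt hW'
    -- Orbits near `o` pass through a unit `y` where the zero section is in `U`. A small vector
    -- carried back to the fibre over `y` keeps its norm, so adding it to `0` stays in the preimage
    -- of `W`.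
    have h1 : ∀ᶠ y in 𝓝 o.out, y ∈ P ∧ (⟨y, 0⟩ : Tot A) ∈ U := by
      have h0 : ContinuousAt (fun y => (⟨y, 0⟩ : Tot A)) o.out :=
        continuousAt_section_iff.2 fun ε hε => ApproxAt.zero _ hε
      exact (eventually_mem_set.2 hP).and (h0.eventually_mem hU)
    have h2 := (isOpenMap_mk_orbit hr).image_mem_nhds h1
    rw [Quotient.out_eq] at h2
    refine mem_inf_of_inter (preimage_mem_comap (Metric.ball_mem_nhds 0 hδ))
      (preimage_mem_comap h2) ?_
    rintro ⟨o', c⟩ ⟨hc, ⟨y, ⟨hyP, hyU⟩, hy⟩⟩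
    obtain rfl : Quotient.mk _ y = o' := hy
    change ‖c‖ ∈ Metric.ball (0 : ℝ) δ at hc
    have hcδ : ‖c‖ < δ := by simpa using hc
    have h3 := hUP y 0 (α.map (Groupoid.inv (toOut y)) c) hyU hyP
      ((α.norm_map (Groupoid.inv (toOut y)) c).trans_lt hcδ)
    rw [zero_add] at h3
    change orbitMap α _ ∈ W at h3
    rwa [(orbitMap_eq_mk_iff hprincipal).2 ⟨toOut y, α.map_map_inv (toOut y) c⟩] at h3

end OrbitBundle

/-! ## The induced algebra as the section algebra of the quotient bundle -/

section InducedAlgebra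

variable {X : Type u} [Groupoid.{v} X] [TopologicalSpace (Arrows X)] [TopologicalSpace X]
  {A : X → Type w} [∀ x, NonUnitalCStarAlgebra (A x)] [TopologicalSpace (Tot A)]
  [IsUSCCStarBundle A] {α : BundleAction A}

lemma inducedAlgebra_equivariant (f : inducedAlgebra α) {x y : X} (γ : x ⟶ y) :
    (f : lp A ∞) y = α.map γ ((f : lp A ∞) x) :=
  f.2.1.2 x y γ

lemma norm_inducedAlgebra_out (f : inducedAlgebra α) (x : X) :
    ‖(f : lp A ∞) (Quotient.mk (orbitSetoid X) x).out‖ = ‖(f : lp A ∞) x‖ := by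
  rw [inducedAlgebra_equivariant f (toOut x), α.norm_map]

variable [IsUSCCStarBundle (OrbitFibre α)]

/-- By equivariance, the restricted section pulled back to `X` is `orbitMap` composed with `f`. It
is therefore continuous, and it descends to the quotient. -/
lemma lpOfBound_out_mem_sectionAlgebra (hprincipal : IsPrincipal X) (f : inducedAlgebra α) :
    lpOfBound (A := OrbitFibre α) (fun o => (f : lp A ∞) o.out) (C := ‖(f : lp A ∞)‖)
      (fun o => lp.norm_apply_le_norm ENNReal.top_ne_zero (f : lp A ∞) o.out) ∈
        sectionAlgebra (OrbitFibre α) := by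
  refine ⟨?_, ?_⟩
  · have hq : IsQuotientMap (Quotient.mk (orbitSetoid X)) := isQuotientMap_quotient_mk'
    have h := (continuous_orbitMap α).comp (show Continuous fun x => (⟨x, (f : lp A ∞) x⟩ : Tot A)
      from f.2.1.1)
    refine hq.continuous_iff.2 (h.congr fun x => ?_)
    exact (orbitMap_eq_mk_iff hprincipal).2
      ⟨toOut x, (inducedAlgebra_equivariant f (toOut x)).symm⟩
  · have h : Tendsto (fun x => ‖(f : lp A ∞) x‖)
      (comap (Quotient.mk (orbitSetoid X)) (cocompact (UnitOrbits X))) (𝓝 0) := f.2.2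
    have h2 : (fun x => ‖(f : lp A ∞) x‖) =
        (fun o : UnitOrbits X => ‖(f : lp A ∞) o.out‖) ∘ Quotient.mk (orbitSetoid X) :=
      funext fun x => (norm_inducedAlgebra_out f x).symm
    rw [h2, tendsto_comap'_iff (by rw [Quotient.mk_surjective.range_eq]; exact univ_mem)] at h
    exact h

/-- Restriction of an element of the induced algebra to the representatives of the orbits is a
section of the quotient bundle. -/
def toOrbitSections (hprincipal : IsPrincipal X) :
    inducedAlgebra α →⋆ₙₐ[ℂ] sectionAlgebra (OrbitFibre α) where
  toFun f := ⟨_, lpOfBound_out_mem_sectionAlgebra hprincipal f⟩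
  map_smul' _ _ := rfl
  map_zero' := rfl
  map_add' _ _ := rfl
  map_mul' _ _ := rfl
  map_star' _ := rfl

lemma toOrbitSections_injective (hprincipal : IsPrincipal X) :
    Function.Injective (toOrbitSections (α := α) hprincipal) := by
  intro f g hfg
  refine Subtype.ext (lp.ext (funext fun x => ?_))
  have h : (f : lp A ∞) (Quotient.mk (orbitSetoid X) x).out =
      (g : lp A ∞) (Quotient.mk (orbitSetoid X) x).out :=
    congrArg (fun s : sectionAlgebra (OrbitFibre α) => (s : lp (OrbitFibre α) ∞) (Quotient.mk _ x))
      hfg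
  rw [inducedAlgebra_equivariant f (toOut x), inducedAlgebra_equivariant g (toOut x)] at h
  rw [← α.map_inv_map (toOut x) ((f : lp A ∞) x), h, α.map_inv_map]

variable [IsTopologicalGroupoid X] [T2Space (Arrows X)] [LocallyCompactSpace (Arrows X)]

/-- A section over the orbits is spread along each orbit by the action. The delicate point is
continuity on `X`: continuity in the quotient controls `f y` only up to an arrow. -/
lemma toOrbitSections_surjective (hprincipal : IsPrincipal X) (hproper : IsProperGroupoid X)
    (hopen : IsOpenMap (fun γ : Arrows X => γ.left)) :
    Function.Surjective (toOrbitSections (α := α) hprincipal) := by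
  intro g
  let s : ∀ o : UnitOrbits X, A o.out := fun o => (g : lp (OrbitFibre α) ∞) o
  let f : ∀ x, A x := fun x => α.map (Groupoid.inv (toOut x)) (s (Quotient.mk _ x))
  have hf : ∀ x, orbitMap α ⟨x, f x⟩ = ⟨Quotient.mk _ x, s (Quotient.mk _ x)⟩ := fun x =>
    (orbitMap_eq_mk_iff hprincipal).2 ⟨toOut x, α.map_map_inv _ _⟩
  have hequiv : ∀ (x y : X) (γ : x ⟶ y), f y = α.map γ (f x) := by
    intro x y γ
    have hxy : Quotient.mk (orbitSetoid X) x = Quotient.mk (orbitSetoid X) y :=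
      Quotient.sound ⟨γ⟩
    have h : orbitMap α ⟨x, f x⟩ = orbitMap α ⟨y, f y⟩ := by rw [hf, hf, hxy]
    obtain ⟨η, hη⟩ := (orbitMap_eq_iff hprincipal).1 h
    rw [← hη, hprincipal.arrow_eq η γ]
  have hnorm : ∀ x, ‖f x‖ = ‖s (Quotient.mk _ x)‖ := fun x => α.norm_map _ _
  have hbound : ∀ x, ‖f x‖ ≤ ‖(g : lp (OrbitFibre α) ∞)‖ := fun x =>
    (hnorm x).trans_le (lp.norm_apply_le_norm ENNReal.top_ne_zero (g : lp (OrbitFibre α) ∞) _)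
  have hgc : Continuous fun x : X =>
      (⟨Quotient.mk _ x, s (Quotient.mk _ x)⟩ : Tot (OrbitFibre α)) :=
    (show Continuous fun o => (⟨o, (g : lp (OrbitFibre α) ∞) o⟩ : Tot (OrbitFibre α)) from
      g.2.1).comp continuous_quotient_mk'
  have hcont : Continuous fun x => (⟨x, f x⟩ : Tot A) := by
    rw [continuous_iff_continuousAt]
    intro x W hW
    obtain ⟨M, hM, P, hP, hMP⟩ := exists_nhds_forall_map_mem (α := α) hprincipal hproper hW
    have hM' := (isOpenQuotientMap_orbitMap (α := α) hprincipal hopen).isOpenMap.image_mem_nhds hM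
    rw [hf] at hM'
    rw [mem_map]
    -- Some `(z, b)` in `M` lies in the orbit of `(y, f y)`; as `y` is near `x`, the arrow from `z`
    -- to `y` keeps it in `W`.
    filter_upwards [hgc.continuousAt.preimage_mem_nhds hM', hP] with y ⟨⟨z, b⟩, hb, hzb⟩ hy
    have hzb' : orbitMap α ⟨z, b⟩ = orbitMap α ⟨y, f y⟩ := hzb.trans (hf y).symm
    obtain ⟨γ, hγ⟩ := (orbitMap_eq_iff hprincipal).1 hzb'
    have := hMP γ b hb hy
    rwa [hγ] at this
  have hvan : Tendsto (fun x => ‖f x‖)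
      (comap (Quotient.mk (orbitSetoid X)) (cocompact (UnitOrbits X))) (𝓝 0) := by
    simp only [hnorm]
    have h : Tendsto (fun o => ‖s o‖) (cocompact (UnitOrbits X)) (𝓝 0) := g.2.2
    exact h.comp tendsto_comap
  refine ⟨⟨lpOfBound f hbound, ⟨hcont, hequiv⟩, hvan⟩, Subtype.ext (lp.ext (funext fun o => ?_))⟩
  change f o.out = s o
  have h : orbitMap α ⟨o.out, f o.out⟩ = ⟨o, s o⟩ := by rw [hf, Quotient.out_eq]
  obtain ⟨γ, hγ⟩ := (orbitMap_eq_mk_iff hprincipal).1 h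
  rw [← hγ, hprincipal _ γ, α.map_id]

lemma exists_inducedAlgebra_smul (hprincipal : IsPrincipal X) (hproper : IsProperGroupoid X)
    (hopen : IsOpenMap (fun γ : Arrows X => γ.left)) (f : inducedAlgebra α)
    {ψ : UnitOrbits X → ℝ} (hψ : Continuous ψ) (h01 : ∀ o, ψ o ∈ Set.Icc (0 : ℝ) 1) :
    ∃ g : inducedAlgebra α, ∀ x,
      (g : lp A ∞) x = (ψ (Quotient.mk _ x) : ℂ) • (f : lp A ∞) x := by
  obtain ⟨h, hh⟩ := exists_sectionAlgebra_smul (toOrbitSections hprincipal f) hψ h01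
  obtain ⟨g, rfl⟩ := toOrbitSections_surjective hprincipal hproper hopen h
  refine ⟨g, fun x => ?_⟩
  have h1 : (g : lp A ∞) (Quotient.mk (orbitSetoid X) x).out =
      (ψ (Quotient.mk _ x) : ℂ) • (f : lp A ∞) (Quotient.mk (orbitSetoid X) x).out :=
    hh (Quotient.mk _ x)
  rw [inducedAlgebra_equivariant g (toOut x), inducedAlgebra_equivariant f (toOut x),
    ← map_smul] at h1
  rw [← α.map_inv_map (toOut x) ((g : lp A ∞) x), h1, α.map_inv_map]

variable [T2Space (UnitOrbits X)] [LocallyCompactSpace (UnitOrbits X)]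

variable {H : Type t} [NormedAddCommGroup H] [InnerProductSpace ℂ H] [CompleteSpace H]

/-- A nonzero representation of the induced algebra lives over at most one orbit. -/
lemma nonempty_arrow_of_forall_evalAt_eq_zero (hprincipal : IsPrincipal X)
    (hproper : IsProperGroupoid X) (hopen : IsOpenMap (fun γ : Arrows X => γ.left))
    {π : inducedAlgebra α →⋆ₙₐ[ℂ] (H →L[ℂ] H)} (h0 : π ≠ 0) {x y : X}
    (hx : ∀ f, evalAt (inducedAlgebra α) x f = 0 → π f = 0)
    (hy : ∀ f, evalAt (inducedAlgebra α) y f = 0 → π f = 0) : Nonempty (x ⟶ y) := by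
  by_contra hxy
  have hne : Quotient.mk (orbitSetoid X) x ≠ Quotient.mk (orbitSetoid X) y := fun h =>
    hxy (Quotient.exact h)
  refine h0 ?_
  ext1 f
  obtain ⟨ψ, hψ, h01, -, h1, hψy⟩ := exists_bump
    (isOpen_ne.mem_nhds hne : {Quotient.mk (orbitSetoid X) y}ᶜ ∈ 𝓝 (Quotient.mk (orbitSetoid X) x))
  obtain ⟨g, hg⟩ := exists_inducedAlgebra_smul hprincipal hproper hopen f hψ h01
  have hgx : π (f - g) = 0 := hx _ <| by
    change (f : lp A ∞) x - (g : lp A ∞) x = 0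
    rw [hg, h1, Complex.ofReal_one, one_smul, sub_self]
  have hgy : π g = 0 := hy _ <| by
    change (g : lp A ∞) y = 0
    rw [hg, hψy _ (by simp)]
    simp
  rwa [map_sub, hgy, sub_zero] at hgx

variable [ParacompactSpace (UnitOrbits X)]

lemma evalAt_inducedAlgebra_surjective (hprincipal : IsPrincipal X) (hproper : IsProperGroupoid X)
    (hopen : IsOpenMap (fun γ : Arrows X => γ.left)) (x : X) :
    Function.Surjective (evalAt (inducedAlgebra α) x) := by
  intro a
  obtain ⟨g, hg⟩ := evalAt_sectionAlgebra_surjective (A := OrbitFibre α) (Quotient.mk _ x)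
    (α.map (toOut x) a)
  obtain ⟨f, rfl⟩ := toOrbitSections_surjective hprincipal hproper hopen g
  refine ⟨f, ?_⟩
  have h1 : (f : lp A ∞) (Quotient.mk (orbitSetoid X) x).out = α.map (toOut x) a := hg
  change (f : lp A ∞) x = a
  rw [inducedAlgebra_equivariant f (toOut x)] at h1
  rw [← α.map_inv_map (toOut x) ((f : lp A ∞) x), h1, α.map_inv_map]

/-- An irreducible representation of the induced algebra lives over a single point. -/
lemma exists_eq_comp_evalAt_inducedAlgebra (hprincipal : IsPrincipal X)
    (hproper : IsProperGroupoid X) (hopen : IsOpenMap (fun γ : Arrows X => γ.left))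
    {ρ : inducedAlgebra α →⋆ₙₐ[ℂ] (H →L[ℂ] H)} (hρ : IsIrreducibleRep ρ) :
    ∃ (x : X) (τ : A x →⋆ₙₐ[ℂ] (H →L[ℂ] H)), ρ = τ.comp (evalAt (inducedAlgebra α) x) := by
  have hsurj := toOrbitSections_surjective (α := α) hprincipal hproper hopen
  -- Transport to the section algebra over the orbits, where evaluation at `o` is evaluation of the
  -- invariant section at the representative of `o`.
  obtain ⟨ρ', rfl⟩ := exists_comp_eq_of_surjective (π := ρ) hsurj fun b hb => by
    rw [toOrbitSections_injective hprincipal (hb.trans (map_zero _).symm), map_zero]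
  obtain ⟨o, τ, rfl⟩ := (hρ.of_comp hsurj).exists_eq_comp_evalAt
  exact ⟨o.out, τ, rfl⟩

end InducedAlgebra

/-! ## The orbits in the spectrum and the spectrum of the induced algebra -/

section SpectrumOrbits

variable {X : Type u} [Groupoid.{v} X] [TopologicalSpace (Arrows X)] [TopologicalSpace X]
  {A : X → Type w} [∀ x, NonUnitalCStarAlgebra (A x)] [TopologicalSpace (Tot A)]
  [IsUSCCStarBundle A] {α : BundleAction A}
  [T2Space X] [LocallyCompactSpace X] [ParacompactSpace X]

lemma FactorsThrough.rep_apply {π : IrrRep.{max u w, t} (sectionAlgebra A)} {x : X}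
    {τ : A x →⋆ₙₐ[ℂ] (π.H →L[ℂ] π.H)} (h : FactorsThrough π x τ) (f : sectionAlgebra A) :
    π.rep f = τ (evalAt (sectionAlgebra A) x f) := by
  rw [h]
  rfl

lemma existsUnique_factorsThrough (π : IrrRep.{max u w, t} (sectionAlgebra A)) :
    ∃! p : (Σ x : X, A x →⋆ₙₐ[ℂ] (π.H →L[ℂ] π.H)), FactorsThrough π p.1 p.2 := by
  obtain ⟨x, τ, hτ⟩ := π.irreducible.exists_eq_comp_evalAt
  refine ⟨⟨x, τ⟩, hτ, ?_⟩
  rintro ⟨y, σ⟩ hσ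
  dsimp only at hσ
  obtain rfl : y = x := eq_of_forall_evalAt_eq_zero π.irreducible.1
    (fun f hf => by rw [hσ.rep_apply, hf, map_zero])
    (fun f hf => by rw [FactorsThrough.rep_apply hτ, hf, map_zero])
  rw [comp_evalAt_injective (hσ.symm.trans hτ)]

lemma exists_factorsThrough (π : IrrRep.{max u w, t} (sectionAlgebra A)) :
    ∃ (x : X) (τ : A x →⋆ₙₐ[ℂ] (π.H →L[ℂ] π.H)), FactorsThrough π x τ :=
  π.irreducible.exists_eq_comp_evalAt

lemma FactorsThrough.isIrreducibleRep {π : IrrRep.{max u w, t} (sectionAlgebra A)} {x : X}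
    {τ : A x →⋆ₙₐ[ℂ] (π.H →L[ℂ] π.H)} (h : FactorsThrough π x τ) : IsIrreducibleRep τ := by
  have hirr := π.irreducible
  rw [h] at hirr
  exact hirr.of_comp (evalAt_sectionAlgebra_surjective x)

lemma FactorsThrough.isIrreducibleRep_translate {π : IrrRep.{max u w, t} (sectionAlgebra A)}
    {x y : X} (γ : x ⟶ y) {τ : A x →⋆ₙₐ[ℂ] (π.H →L[ℂ] π.H)} (h : FactorsThrough π x τ) :
    IsIrreducibleRep ((τ.comp (α.invMap γ)).comp (evalAt (sectionAlgebra A) y)) :=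
  (h.isIrreducibleRep.comp (ε := α.invMap γ) (α.map γ).symm.surjective).comp
    (evalAt_sectionAlgebra_surjective y)

lemma FactorsThrough.mk_eq {π : IrrRep.{max u w, t} (sectionAlgebra A)} {x : X}
    {τ : A x →⋆ₙₐ[ℂ] (π.H →L[ℂ] π.H)} (h : FactorsThrough π x τ)
    (hτ : IsIrreducibleRep (τ.comp (evalAt (sectionAlgebra A) x))) : IrrRep.mk π.H _ hτ = π := by
  have key : ∀ (r : sectionAlgebra A →⋆ₙₐ[ℂ] (π.H →L[ℂ] π.H)) (hr : IsIrreducibleRep r),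
      π.rep = r → IrrRep.mk π.H r hr = π := by
    rintro r hr rfl
    rfl
  exact key _ hτ h

lemma FactorsThrough.isIrreducibleRep_comp {π : IrrRep.{max u w, t} (sectionAlgebra A)} {x : X}
    {τ : A x →⋆ₙₐ[ℂ] (π.H →L[ℂ] π.H)} (h : FactorsThrough π x τ) :
    IsIrreducibleRep (τ.comp (evalAt (sectionAlgebra A) x)) := by
  rw [← show π.rep = _ from h]
  exact π.irreducible

lemma OrbitRel.exists_mk {p q : Spectrum.{max u w, t} (sectionAlgebra A)}
    (h : OrbitRel.{u, v, w, t} α p q) :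
    ∃ (K : Type t) (_ : NormedAddCommGroup K) (_ : InnerProductSpace ℂ K) (_ : CompleteSpace K)
      (x y : X) (γ : x ⟶ y) (τ : A x →⋆ₙₐ[ℂ] (K →L[ℂ] K))
      (hp : IsIrreducibleRep (τ.comp (evalAt (sectionAlgebra A) x)))
      (hq : IsIrreducibleRep ((τ.comp (α.invMap γ)).comp (evalAt (sectionAlgebra A) y))),
      (IrrRep.mk K _ hp).toSpectrum = p ∧ (IrrRep.mk K _ hq).toSpectrum = q := by
  obtain ⟨π, x, y, γ, τ, hp, hf, h, hq⟩ := h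
  exact ⟨π.H, _, _, _, x, y, γ, τ, hf.isIrreducibleRep_comp, h, by rw [hf.mk_eq, hp], hq⟩

/-! ### Orbits described by intertwiners -/

section Intertwiners

variable {H : Type t} [NormedAddCommGroup H] [InnerProductSpace ℂ H] [CompleteSpace H]
  {H' : Type t} [NormedAddCommGroup H'] [InnerProductSpace ℂ H'] [CompleteSpace H']

/-- Equivalent irreducible representations of the section algebra come from equivalent
representations of the same fibre. -/
lemma exists_intertwiner {x y : X} {τ : A x →⋆ₙₐ[ℂ] (H →L[ℂ] H)} {σ : A y →⋆ₙₐ[ℂ] (H' →L[ℂ] H')}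
    (hτ : IsIrreducibleRep (τ.comp (evalAt (sectionAlgebra A) x)))
    (hσ : IsIrreducibleRep (σ.comp (evalAt (sectionAlgebra A) y)))
    (h : (IrrRep.mk H _ hτ).toSpectrum = (IrrRep.mk H' _ hσ).toSpectrum) :
    ∃ (hxy : x = y) (U : H ≃ₗᵢ[ℂ] H'), ∀ a ξ, U (τ a ξ) = σ (hxy ▸ a) (U ξ) := by
  obtain ⟨U, hU⟩ := (toSpectrum_mk_eq_iff hτ hσ).1 h
  have hxy : x = y := by
    refine eq_of_forall_evalAt_eq_zero hτ.1 (fun f hf => ?_)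
      fun f hf => eq_zero_of_intertwiner hU ?_
    · change τ (evalAt (sectionAlgebra A) x f) = 0
      rw [hf, map_zero]
    · change σ (evalAt (sectionAlgebra A) y f) = 0
      rw [hf, map_zero]
  subst hxy
  refine ⟨rfl, U, fun a ξ => ?_⟩
  obtain ⟨f, rfl⟩ := evalAt_sectionAlgebra_surjective x a
  exact hU f ξ

/-- The orbit relation involves two unitary equivalences, at the source and at the range. Each
forces its base points to agree, and composing the unitaries leaves one arrow and one intertwiner.
-/
lemma orbitRel_mk_iff {x y : X} {τ : A x →⋆ₙₐ[ℂ] (H →L[ℂ] H)} {σ : A y →⋆ₙₐ[ℂ] (H' →L[ℂ] H')}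
    (hτ : IsIrreducibleRep (τ.comp (evalAt (sectionAlgebra A) x)))
    (hσ : IsIrreducibleRep (σ.comp (evalAt (sectionAlgebra A) y))) :
    OrbitRel.{u, v, w, t} α (IrrRep.mk H _ hτ).toSpectrum (IrrRep.mk H' _ hσ).toSpectrum ↔
      ∃ (γ : x ⟶ y) (U : H ≃ₗᵢ[ℂ] H'), ∀ a ξ, U (τ a ξ) = σ (α.map γ a) (U ξ) := by
  constructor
  · intro h
    obtain ⟨K, _, _, _, x', y', γ, τ', hp, hq, hπ, hρ⟩ := h.exists_mk
    obtain ⟨rfl, U, hU⟩ := exists_intertwiner hp hτ hπ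
    obtain ⟨rfl, V, hV⟩ := exists_intertwiner hq hσ hρ
    refine ⟨γ, U.symm.trans V, fun a ξ => ?_⟩
    obtain ⟨ξ, rfl⟩ := U.surjective ξ
    have h1 := hV (α.map γ a) ξ
    have h2 : α.invMap γ (α.map γ a) = a := by rw [α.invMap_eq, α.map_inv_map]
    change V (τ' (α.invMap γ (α.map γ a)) ξ) = _ at h1
    rw [h2] at h1
    rw [← hU, LinearIsometryEquiv.trans_apply, LinearIsometryEquiv.trans_apply,
      LinearIsometryEquiv.symm_apply_apply, LinearIsometryEquiv.symm_apply_apply]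
    exact h1
  · rintro ⟨γ, U, hU⟩
    refine ⟨IrrRep.mk H _ hτ, x, y, γ, τ, rfl, rfl,
      FactorsThrough.isIrreducibleRep_translate (π := IrrRep.mk H _ hτ) γ rfl,
      (toSpectrum_mk_eq_iff _ hσ).2 ⟨U, fun f ξ => ?_⟩⟩
    change U (τ (α.invMap γ (evalAt (sectionAlgebra A) y f)) ξ) =
      σ (evalAt (sectionAlgebra A) y f) (U ξ)
    rw [hU, α.invMap_eq, α.map_map_inv]

end Intertwiners

lemma orbitRel_iff {π ρ : IrrRep.{max u w, t} (sectionAlgebra A)}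
    {x y : X} {τ : A x →⋆ₙₐ[ℂ] (π.H →L[ℂ] π.H)} {σ : A y →⋆ₙₐ[ℂ] (ρ.H →L[ℂ] ρ.H)}
    (hτ : FactorsThrough π x τ) (hσ : FactorsThrough ρ y σ) :
    OrbitRel.{u, v, w, t} α π.toSpectrum ρ.toSpectrum ↔
      ∃ (γ : x ⟶ y) (U : π.H ≃ₗᵢ[ℂ] ρ.H), ∀ a ξ, U (τ a ξ) = σ (α.map γ a) (U ξ) := by
  have h := orbitRel_mk_iff (α := α) hτ.isIrreducibleRep_comp hσ.isIrreducibleRep_comp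
  rwa [hτ.mk_eq, hσ.mk_eq] at h

lemma equivalence_orbitRel : _root_.Equivalence (OrbitRel.{u, v, w, t} α) where
  refl p := by
    obtain ⟨π, rfl⟩ := Quotient.exists_rep p
    obtain ⟨x, τ, hτ⟩ := exists_factorsThrough π
    exact (orbitRel_iff hτ hτ).2
      ⟨𝟙 x, LinearIsometryEquiv.refl ℂ π.H, fun a ξ => by rw [α.map_id]; rfl⟩
  symm {p q} h := by
    obtain ⟨π, rfl⟩ := Quotient.exists_rep p
    obtain ⟨ρ, rfl⟩ := Quotient.exists_rep q
    obtain ⟨x, τ, hτ⟩ := exists_factorsThrough π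
    obtain ⟨y, σ, hσ⟩ := exists_factorsThrough ρ
    obtain ⟨γ, U, hU⟩ := (orbitRel_iff hτ hσ).1 h
    refine (orbitRel_iff hσ hτ).2 ⟨Groupoid.inv γ, U.symm, fun a ξ => ?_⟩
    rw [LinearIsometryEquiv.symm_apply_eq, hU, α.map_map_inv,
      LinearIsometryEquiv.apply_symm_apply]
  trans {p q r} h h' := by
    obtain ⟨π, rfl⟩ := Quotient.exists_rep p
    obtain ⟨ρ, rfl⟩ := Quotient.exists_rep q
    obtain ⟨κ, rfl⟩ := Quotient.exists_rep r
    obtain ⟨x, τ, hτ⟩ := exists_factorsThrough π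
    obtain ⟨y, σ, hσ⟩ := exists_factorsThrough ρ
    obtain ⟨z, υ, hυ⟩ := exists_factorsThrough κ
    obtain ⟨γ, U, hU⟩ := (orbitRel_iff hτ hσ).1 h
    obtain ⟨η, V, hV⟩ := (orbitRel_iff hσ hυ).1 h'
    exact (orbitRel_iff hτ hυ).2 ⟨γ ≫ η, U.trans V, fun a ξ => by
      simp only [LinearIsometryEquiv.trans_apply, hU, hV, α.map_comp]⟩

variable [IsUSCCStarBundle (OrbitFibre α)] [IsTopologicalGroupoid X] [T2Space (Arrows X)]
  [LocallyCompactSpace (Arrows X)] [T2Space (UnitOrbits X)] [LocallyCompactSpace (UnitOrbits X)]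
  [ParacompactSpace (UnitOrbits X)]

lemma FactorsThrough.isIrreducibleRep_induced (hprincipal : IsPrincipal X)
    (hproper : IsProperGroupoid X) (hopen : IsOpenMap (fun γ : Arrows X => γ.left))
    {π : IrrRep.{max u w, t} (sectionAlgebra A)} {x : X}
    {τ : A x →⋆ₙₐ[ℂ] (π.H →L[ℂ] π.H)} (h : FactorsThrough π x τ) :
    IsIrreducibleRep (τ.comp (evalAt (inducedAlgebra α) x)) :=
  h.isIrreducibleRep.comp (evalAt_inducedAlgebra_surjective hprincipal hproper hopen x)

/-- A common class lives over a single orbit, which provides `γ`. Equivariance turns evaluation at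
`y` into `α.map γ` after evaluation at `x`, so the condition coincides with the one for the orbit
relation. -/
lemma induced_toSpectrum_eq_iff (hprincipal : IsPrincipal X)
    (hproper : IsProperGroupoid X) (hopen : IsOpenMap (fun γ : Arrows X => γ.left))
    {H : Type t} [NormedAddCommGroup H] [InnerProductSpace ℂ H] [CompleteSpace H]
    {H' : Type t} [NormedAddCommGroup H'] [InnerProductSpace ℂ H'] [CompleteSpace H']
    {x y : X} {τ : A x →⋆ₙₐ[ℂ] (H →L[ℂ] H)} {σ : A y →⋆ₙₐ[ℂ] (H' →L[ℂ] H')}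
    (hτ : IsIrreducibleRep (τ.comp (evalAt (inducedAlgebra α) x)))
    (hσ : IsIrreducibleRep (σ.comp (evalAt (inducedAlgebra α) y))) :
    (IrrRep.mk H _ hτ).toSpectrum = (IrrRep.mk H' _ hσ).toSpectrum ↔
      ∃ (γ : x ⟶ y) (U : H ≃ₗᵢ[ℂ] H'), ∀ a ξ, U (τ a ξ) = σ (α.map γ a) (U ξ) := by
  rw [toSpectrum_mk_eq_iff hτ hσ]
  have hequiv : ∀ (γ : x ⟶ y) (b : inducedAlgebra α),
      evalAt (inducedAlgebra α) y b = α.map γ (evalAt (inducedAlgebra α) x b) :=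
    fun γ b => inducedAlgebra_equivariant b γ
  constructor
  · rintro ⟨U, hU⟩
    obtain ⟨γ⟩ : Nonempty (x ⟶ y) := by
      refine nonempty_arrow_of_forall_evalAt_eq_zero hprincipal hproper hopen hτ.1
        (fun f hf => ?_) fun f hf => eq_zero_of_intertwiner hU ?_
      · change τ (evalAt (inducedAlgebra α) x f) = 0
        rw [hf, map_zero]
      · change σ (evalAt (inducedAlgebra α) y f) = 0
        rw [hf, map_zero]
    refine ⟨γ, U, fun a ξ => ?_⟩
    obtain ⟨b, hb⟩ := evalAt_inducedAlgebra_surjective (α := α) hprincipal hproper hopen x a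
    have h := hU b ξ
    change U (τ (evalAt (inducedAlgebra α) x b) ξ) = σ (evalAt (inducedAlgebra α) y b) (U ξ) at h
    rwa [hequiv γ, hb] at h
  · rintro ⟨γ, U, hU⟩
    refine ⟨U, fun b ξ => ?_⟩
    change U (τ (evalAt (inducedAlgebra α) x b) ξ) = σ (evalAt (inducedAlgebra α) y b) (U ξ)
    rw [hequiv γ, hU]

end SpectrumOrbits

/-! ## Continuity and openness of the induction map -/

section Homeomorphism

variable {X : Type u} [Groupoid.{v} X] [TopologicalSpace (Arrows X)] [TopologicalSpace X]
  {A : X → Type w} [∀ x, NonUnitalCStarAlgebra (A x)] [TopologicalSpace (Tot A)]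
  [IsUSCCStarBundle A] {α : BundleAction A}
  [T2Space X] [LocallyCompactSpace X] [ParacompactSpace X]
  [IsUSCCStarBundle (OrbitFibre α)] [IsTopologicalGroupoid X] [T2Space (Arrows X)]
  [LocallyCompactSpace (Arrows X)] [T2Space (UnitOrbits X)] [LocallyCompactSpace (UnitOrbits X)]
  [ParacompactSpace (UnitOrbits X)]

lemma map_smul_eq_zero_of_map_eq_zero {B D : Type*} [NonUnitalCStarAlgebra B]
    [NonUnitalCStarAlgebra D] {σ : B →⋆ₙₐ[ℂ] D} (c : ℂ) {b : B} (h : σ b = 0) : σ (c • b) = 0 := by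
  rw [map_smul, h, smul_zero]

/-- `F` sends the class of `τ ∘ ε_x` on the section algebra to the class of `τ ∘ ε_x` on the induced
algebra. -/
def IsInductionMap (F : Spectrum.{max u w, t} (sectionAlgebra A) →
    Spectrum.{max u w, t} (inducedAlgebra α)) : Prop :=
  ∀ (π : IrrRep.{max u w, t} (sectionAlgebra A)) (x : X) (τ : A x →⋆ₙₐ[ℂ] (π.H →L[ℂ] π.H)),
    FactorsThrough π x τ → ∀ h : IsIrreducibleRep (τ.comp (evalAt (inducedAlgebra α) x)),
      F π.toSpectrum = (IrrRep.mk π.H _ h).toSpectrum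

lemma exists_isInductionMap (hprincipal : IsPrincipal X)
    (hproper : IsProperGroupoid X) (hopen : IsOpenMap (fun γ : Arrows X => γ.left)) :
    ∃ F : Spectrum.{max u w, t} (sectionAlgebra A) → Spectrum.{max u w, t} (inducedAlgebra α),
      IsInductionMap F := by
  -- Quantifying over all representatives and factorisations makes a mere choice of `q` a
  -- well-defined map.
  have h : ∀ p : Spectrum.{max u w, t} (sectionAlgebra A),
      ∃ q : Spectrum.{max u w, t} (inducedAlgebra α),
        ∀ (π : IrrRep.{max u w, t} (sectionAlgebra A)) (x : X)
          (τ : A x →⋆ₙₐ[ℂ] (π.H →L[ℂ] π.H)), π.toSpectrum = p → FactorsThrough π x τ →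
          ∀ h : IsIrreducibleRep (τ.comp (evalAt (inducedAlgebra α) x)),
            q = (IrrRep.mk π.H _ h).toSpectrum := by
    intro p
    obtain ⟨π, rfl⟩ := Quotient.exists_rep p
    obtain ⟨x, τ, hτ⟩ := exists_factorsThrough π
    refine ⟨(IrrRep.mk π.H _
      (hτ.isIrreducibleRep_induced (α := α) hprincipal hproper hopen)).toSpectrum, ?_⟩
    intro ρ y σ hρ hσ h
    rw [induced_toSpectrum_eq_iff hprincipal hproper hopen, ← orbitRel_iff hτ hσ, hρ]
    exact equivalence_orbitRel.refl _
  choose F hF using h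
  exact ⟨F, fun π x τ hτ h => hF _ π x τ rfl hτ h⟩

variable {F : Spectrum.{max u w, t} (sectionAlgebra A) → Spectrum.{max u w, t} (inducedAlgebra α)}

lemma IsInductionMap.eq_iff (hprincipal : IsPrincipal X) (hproper : IsProperGroupoid X)
    (hopen : IsOpenMap (fun γ : Arrows X => γ.left)) (hF : IsInductionMap F)
    (p q : Spectrum.{max u w, t} (sectionAlgebra A)) :
    F p = F q ↔ OrbitRel.{u, v, w, t} α p q := by
  obtain ⟨π, rfl⟩ := Quotient.exists_rep p
  obtain ⟨ρ, rfl⟩ := Quotient.exists_rep q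
  obtain ⟨x, τ, hτ⟩ := exists_factorsThrough π
  obtain ⟨y, σ, hσ⟩ := exists_factorsThrough ρ
  have h1 := hτ.isIrreducibleRep_induced (α := α) hprincipal hproper hopen
  have h2 := hσ.isIrreducibleRep_induced (α := α) hprincipal hproper hopen
  have h := induced_toSpectrum_eq_iff hprincipal hproper hopen h1 h2
  rw [← orbitRel_iff hτ hσ, ← hF π x τ hτ, ← hF ρ y σ hσ] at h
  exact h

/-- Every irreducible representation of the induced algebra is of the form `τ ∘ ε_x`, where
`τ ∘ ε_x` is irreducible on the section algebra. -/
lemma exists_eq_mk_of_irrRep (hprincipal : IsPrincipal X) (hproper : IsProperGroupoid X)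
    (hopen : IsOpenMap (fun γ : Arrows X => γ.left))
    (ρ : IrrRep.{max u w, t} (inducedAlgebra α)) :
    ∃ (x : X) (τ : A x →⋆ₙₐ[ℂ] (ρ.H →L[ℂ] ρ.H)),
      IsIrreducibleRep (τ.comp (evalAt (sectionAlgebra A) x)) ∧
      ρ.rep = τ.comp (evalAt (inducedAlgebra α) x) ∧
      ∃ h : IsIrreducibleRep (τ.comp (evalAt (inducedAlgebra α) x)), ρ = IrrRep.mk ρ.H _ h := by
  obtain ⟨H, ρ, hρ⟩ := ρ
  obtain ⟨x, τ, rfl⟩ := exists_eq_comp_evalAt_inducedAlgebra hprincipal hproper hopen hρ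
  exact ⟨x, τ, (hρ.of_comp (evalAt_inducedAlgebra_surjective hprincipal hproper hopen x)).comp
    (evalAt_sectionAlgebra_surjective x), rfl, hρ, rfl⟩

lemma IsInductionMap.surjective (hprincipal : IsPrincipal X) (hproper : IsProperGroupoid X)
    (hopen : IsOpenMap (fun γ : Arrows X => γ.left)) (hF : IsInductionMap F) :
    Function.Surjective F := by
  intro q
  obtain ⟨ρ, rfl⟩ := Quotient.exists_rep q
  obtain ⟨x, τ, h, -, h', hρ⟩ := exists_eq_mk_of_irrRep hprincipal hproper hopen ρ
  refine ⟨(IrrRep.mk ρ.H _ h).toSpectrum, ?_⟩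
  rw [hF (IrrRep.mk ρ.H _ h) x τ rfl h']
  exact congrArg IrrRep.toSpectrum hρ.symm

/-- Let `b` separate the image point from the complement of `V`. Multiplied by a compactly supported
bump equal to `1` at `x`, it becomes an element of the section algebra with the same value at `x`
and a scalar multiple of `b y` at each `y`, so it separates on the other side. -/
lemma IsInductionMap.continuous (hprincipal : IsPrincipal X) (hproper : IsProperGroupoid X)
    (hopen : IsOpenMap (fun γ : Arrows X => γ.left)) (hF : IsInductionMap F) :
    Continuous F := by
  refine ⟨fun V hV => isOpen_spectrum_iff.2 fun π hπ => ?_⟩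
  obtain ⟨x, τ, hτ⟩ := exists_factorsThrough π
  have h1 := hτ.isIrreducibleRep_induced (α := α) hprincipal hproper hopen
  rw [Set.mem_preimage, hF π x τ hτ h1] at hπ
  obtain ⟨b, hb, hbV⟩ := isOpen_spectrum_iff.1 hV _ hπ
  change τ (evalAt (inducedAlgebra α) x b) ≠ 0 at hb
  obtain ⟨φ, hφ, h01, hc, hφ1, -⟩ := exists_bump (x := x) univ_mem
  obtain ⟨a, ha⟩ := exists_sectionAlgebra_smul_of_hasCompactSupport b.2.1.1 hφ h01 hc
  have hax : evalAt (sectionAlgebra A) x a = evalAt (inducedAlgebra α) x b :=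
    (ha x).trans (by rw [hφ1, Complex.ofReal_one, one_smul]; rfl)
  refine ⟨a, fun h0 => hb ?_, fun ρ hρ => ?_⟩
  · exact (congrArg τ hax).symm.trans ((hτ.rep_apply a).symm.trans h0)
  · obtain ⟨y, σ, hσ⟩ := exists_factorsThrough ρ
    have h2 := hσ.isIrreducibleRep_induced (α := α) hprincipal hproper hopen
    rw [Set.mem_preimage, hF ρ y σ hσ h2] at hρ
    have h3 : σ (evalAt (inducedAlgebra α) y b) = 0 := hbV _ hρ
    have hay : evalAt (sectionAlgebra A) y a = (φ y : ℂ) • evalAt (inducedAlgebra α) y b := ha y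
    exact (hσ.rep_apply a).trans ((congrArg σ hay).trans (map_smul_eq_zero_of_map_eq_zero _ h3))

/-- An element of the section algebra that is killed by a closed invariant set of irreducible
representations is, at a given point, the value of an element of the induced algebra that is
almost killed by these representations. -/
lemma exists_inducedAlgebra_norm_le (hprincipal : IsPrincipal X) (hproper : IsProperGroupoid X)
    (hl : IsOpenMap (fun γ : Arrows X => γ.left)) (hr : IsOpenMap (fun γ : Arrows X => γ.right))
    (a : sectionAlgebra A) (x : X) {ε : ℝ} (hε : 0 < ε) :
    ∃ b : inducedAlgebra α, evalAt (inducedAlgebra α) x b = evalAt (sectionAlgebra A) x a ∧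
      ∀ {H : Type t} [NormedAddCommGroup H] [InnerProductSpace ℂ H] [CompleteSpace H] (y : X)
        (σ : A y →⋆ₙₐ[ℂ] (H →L[ℂ] H)),
        (∀ (z : X) (γ : y ⟶ z), σ (α.invMap γ (evalAt (sectionAlgebra A) z a)) = 0) →
          ‖σ (evalAt (inducedAlgebra α) y b)‖ ≤ ε := by
  obtain ⟨b₀, hb₀⟩ := evalAt_inducedAlgebra_surjective (α := α) hprincipal hproper hl x
    (evalAt (sectionAlgebra A) x a)
  have hsub : Continuous fun y => (⟨y, (b₀ : lp A ∞) y - (a : lp A ∞) y⟩ : Tot A) :=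
    continuous_section_sub b₀.2.1.1 a.2.1
  have hN : ∀ᶠ y in 𝓝 x, ‖(b₀ : lp A ∞) y - (a : lp A ∞) y‖ < ε := by
    refine upperSemicontinuous_norm_section hsub x ε ?_
    have h0 : ‖(b₀ : lp A ∞) x - (a : lp A ∞) x‖ = 0 := by
      rw [norm_eq_zero, sub_eq_zero]
      exact hb₀
    exact h0.trans_lt hε
  -- The cut-off lives on the orbit space to preserve equivariance. Closeness of `b₀` and `a` at one
  -- unit of an orbit is enough, because `σ` kills every translate of `a`.
  obtain ⟨ψ, hψ, h01, -, h1, h0⟩ := exists_bump ((isOpenMap_mk_orbit hr).image_mem_nhds hN)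
  obtain ⟨b, hb⟩ := exists_inducedAlgebra_smul hprincipal hproper hl b₀ hψ h01
  refine ⟨b, ?_, fun {H} _ _ _ y σ hσ => ?_⟩
  · change (b : lp A ∞) x = _
    rw [hb, h1, Complex.ofReal_one, one_smul]
    exact hb₀
  · by_cases hy : Quotient.mk (orbitSetoid X) y ∈ Quotient.mk (orbitSetoid X) ''
      {y | ‖(b₀ : lp A ∞) y - (a : lp A ∞) y‖ < ε}
    · obtain ⟨z, hz, hzy⟩ := hy
      obtain ⟨γ⟩ : Nonempty (y ⟶ z) := Quotient.exact hzy.symm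
      have hby : evalAt (inducedAlgebra α) y b =
          (ψ (Quotient.mk _ y) : ℂ) • α.map (Groupoid.inv γ) ((b₀ : lp A ∞) z) := by
        change (b : lp A ∞) y = _
        rw [hb, ← inducedAlgebra_equivariant b₀ (Groupoid.inv γ)]
      have hσa : σ (α.map (Groupoid.inv γ) ((a : lp A ∞) z)) = 0 := by
        rw [← α.invMap_eq]
        exact hσ z γ
      have h3 : σ (evalAt (inducedAlgebra α) y b) = (ψ (Quotient.mk _ y) : ℂ) •
          σ (α.map (Groupoid.inv γ) ((b₀ : lp A ∞) z - (a : lp A ∞) z)) := by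
        rw [hby, map_smul, map_sub, map_sub, hσa, sub_zero]
      rw [h3, norm_smul, Complex.norm_real, Real.norm_eq_abs, abs_of_nonneg (h01 _).1]
      refine (mul_le_of_le_one_left (norm_nonneg _) (h01 _).2).trans ?_
      refine (NonUnitalStarAlgHom.norm_apply_le σ _).trans ?_
      rw [α.norm_map]
      exact le_of_lt hz
    · have : evalAt (inducedAlgebra α) y b = 0 := by
        change (b : lp A ∞) y = 0
        rw [hb, h0 _ hy]
        simp
      rw [this, map_zero, norm_zero]
      exact hε.le

set_option maxHeartbeats 1000000 in
-- Let `a` separate `π` from the complement of `V`. The invariant section `b` has norm `‖π.rep a‖`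
-- under the induced representation, but at most half of it outside `F '' V`, where invariance of
-- `V` keeps all translates outside `V`. The element `c`, which vanishes exactly where the norm of
-- `b` is at most this half, separates exactly.
lemma IsInductionMap.isOpen_image (hprincipal : IsPrincipal X) (hproper : IsProperGroupoid X)
    (hl : IsOpenMap (fun γ : Arrows X => γ.left)) (hr : IsOpenMap (fun γ : Arrows X => γ.right))
    (hF : IsInductionMap F) {V : Set (Spectrum.{max u w, t} (sectionAlgebra A))} (hV : IsOpen V)
    (hinv : ∀ p q, OrbitRel.{u, v, w, t} α p q → q ∈ V → p ∈ V) : IsOpen (F '' V) := by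
  rw [isOpen_spectrum_iff]
  rintro ρ ⟨p, hp, hpρ⟩
  obtain ⟨π, rfl⟩ := Quotient.exists_rep p
  obtain ⟨x, τ, hτ⟩ := exists_factorsThrough π
  obtain ⟨a, ha, haV⟩ := isOpen_spectrum_iff.1 hV π hp
  have hpos : 0 < ‖π.rep a‖ := norm_pos_iff.2 ha
  obtain ⟨b, hb, hbσ⟩ := exists_inducedAlgebra_norm_le (α := α) hprincipal hproper hl hr a x
    (half_pos hpos)
  obtain ⟨c, hc⟩ := exists_map_eq_zero_iff_norm_le b (half_pos hpos).le
  have h1 := hτ.isIrreducibleRep_induced (α := α) hprincipal hproper hl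
  have hpρ' : (IrrRep.mk π.H _ h1).toSpectrum = ρ.toSpectrum := (hF π x τ hτ h1).symm.trans hpρ
  refine ⟨c, rep_ne_zero_of_toSpectrum_eq hpρ' fun h0 => ?_, fun κ hκ => ?_⟩
  · have h2 : ‖τ (evalAt (inducedAlgebra α) x b)‖ ≤ ‖π.rep a‖ / 2 :=
      (hc (τ.comp (evalAt (inducedAlgebra α) x))).1 h0
    have h3 : π.rep a = τ (evalAt (inducedAlgebra α) x b) :=
      (hτ.rep_apply a).trans (congrArg τ hb.symm)
    rw [← h3] at h2
    linarith
  · obtain ⟨y, σ, h, hrep, h', hκ'⟩ := exists_eq_mk_of_irrRep hprincipal hproper hl κ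
    refine (hc κ.rep).2 ?_
    rw [hrep]
    refine hbσ y σ fun z γ => ?_
    have hσ : FactorsThrough (IrrRep.mk κ.H _ h) y σ := rfl
    have hz := hσ.isIrreducibleRep_translate (α := α) γ
    refine haV (IrrRep.mk κ.H _ hz) fun hzV => hκ ⟨(IrrRep.mk κ.H _ h).toSpectrum, ?_, ?_⟩
    · exact hinv _ _ ⟨IrrRep.mk κ.H _ h, y, z, γ, σ, rfl, hσ, hz, rfl⟩ hzV
    · rw [hF _ y σ hσ h']
      exact congrArg IrrRep.toSpectrum hκ'.symm

/-- The induction map is a homeomorphism of the orbit space onto the spectrum of the induced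
algebra. -/
lemma exists_homeomorph (hprincipal : IsPrincipal X) (hproper : IsProperGroupoid X)
    (hl : IsOpenMap (fun γ : Arrows X => γ.left)) (hr : IsOpenMap (fun γ : Arrows X => γ.right)) :
    ∃ Φ : SpectrumOrbits.{u, v, w, t} α ≃ₜ Spectrum.{max u w, t} (inducedAlgebra α),
      ∀ (π : IrrRep.{max u w, t} (sectionAlgebra A)) (x : X)
        (τ : A x →⋆ₙₐ[ℂ] (π.H →L[ℂ] π.H)), FactorsThrough π x τ →
        ∀ h : IsIrreducibleRep (τ.comp (evalAt (inducedAlgebra α) x)),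
          Φ (Quot.mk _ π.toSpectrum) = (IrrRep.mk π.H _ h).toSpectrum := by
  obtain ⟨F, hF⟩ := exists_isInductionMap.{u, v, w, t} (α := α) hprincipal hproper hl
  have heq := hF.eq_iff hprincipal hproper hl
  let G : SpectrumOrbits.{u, v, w, t} α → Spectrum.{max u w, t} (inducedAlgebra α) :=
    Quot.lift F fun p q h => (heq p q).2 h
  have hinj : Function.Injective G := by
    rintro ⟨p⟩ ⟨q⟩ h
    exact Quot.sound ((heq p q).1 h)
  have hsurj : Function.Surjective G := fun q => by
    obtain ⟨p, rfl⟩ := hF.surjective hprincipal hproper hl q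
    exact ⟨Quot.mk _ p, rfl⟩
  have hcont : Continuous G := continuous_quot_lift _ (hF.continuous hprincipal hproper hl)
  have hopen : IsOpenMap G := by
    intro S hS
    have hG : G '' S = F '' (Quot.mk _ ⁻¹' S) := by
      ext q
      constructor
      · rintro ⟨⟨p⟩, hp, rfl⟩
        exact ⟨p, hp, rfl⟩
      · rintro ⟨p, hp, rfl⟩
        exact ⟨_, hp, rfl⟩
    rw [hG]
    refine hF.isOpen_image hprincipal hproper hl hr (hS.preimage continuous_quot_mk) ?_
    intro p q hpq hq
    change Quot.mk _ p ∈ S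
    rw [Quot.sound hpq]
    exact hq
  exact ⟨(Equiv.ofBijective G ⟨hinj, hsurj⟩).toHomeomorphOfContinuousOpen hcont hopen, hF⟩

end Homeomorphism

end IndAlg

end

theorem lemma3p8 {X : Type u} [Groupoid.{v} X]
    [TopologicalSpace X] [TopologicalSpace (Arrows X)] [IsTopologicalGroupoid X]
    [SecondCountableTopology (Arrows X)] [LocallyCompactSpace (Arrows X)] [T2Space (Arrows X)]
    [MeasurableSpace (Arrows X)] [BorelSpace (Arrows X)] (_haar : HaarSystem X)
    (_principal : IsPrincipal X) (_proper : IsProperGroupoid X)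
    {A : X → Type w} [∀ x, NonUnitalCStarAlgebra (A x)] [TopologicalSpace (Tot A)]
    [IsUSCCStarBundle A] [TopologicalSpace.SeparableSpace (sectionAlgebra A)]
    (α : BundleAction A) :
    -- every irreducible representation `π` of `Γ₀(X, 𝒜)` is `π_x ∘ ε_x` for a unique `x` and `π_x`
    (∀ π : IrrRep.{max u w, t} (sectionAlgebra A),
      ∃! p : (Σ x : X, A x →⋆ₙₐ[ℂ] (π.H →L[ℂ] π.H)), FactorsThrough π p.1 p.2) ∧
    -- `γ · π = π_x ∘ α_γ⁻¹ ∘ ε_y` is again an irreducible representation, for `γ : x ⟶ y`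
    (∀ (π : IrrRep.{max u w, t} (sectionAlgebra A)) (x y : X) (γ : x ⟶ y)
      (τ : A x →⋆ₙₐ[ℂ] (π.H →L[ℂ] π.H)), FactorsThrough π x τ →
        IsIrreducibleRep ((τ.comp (α.invMap γ)).comp (evalAt (sectionAlgebra A) y))) ∧
    -- the orbits in the spectrum of `Γ₀(X, 𝒜)` are the classes of an equivalence relation
    _root_.Equivalence (OrbitRel.{u, v, w, t} α) ∧
    -- `M(π) = π_x ∘ ε_x` is an irreducible representation of the induced algebra
    (∀ (π : IrrRep.{max u w, t} (sectionAlgebra A)) (x : X)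
      (τ : A x →⋆ₙₐ[ℂ] (π.H →L[ℂ] π.H)), FactorsThrough π x τ →
        IsIrreducibleRep (τ.comp (evalAt (inducedAlgebra α) x))) ∧
    -- `M` induces a homeomorphism from the orbit space onto the spectrum of the induced algebra
    ∃ Φ : SpectrumOrbits.{u, v, w, t} α ≃ₜ Spectrum.{max u w, t} (inducedAlgebra α),
      ∀ (π : IrrRep.{max u w, t} (sectionAlgebra A)) (x : X)
        (τ : A x →⋆ₙₐ[ℂ] (π.H →L[ℂ] π.H)), FactorsThrough π x τ →
        ∀ h : IsIrreducibleRep (τ.comp (evalAt (inducedAlgebra α) x)),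
          Φ (Quot.mk _ π.toSpectrum) = (IrrRep.mk π.H _ h).toSpectrum := by
  -- The Haar system enters only through the openness of source and range.
  have hl := _haar.isOpenMap_source
  have hr := _haar.isOpenMap_range
  have := t2Space_unitSpace X
  -- Second countability and local compactness make the unit space paracompact, and below the orbit
  -- space too, as the existence of sections requires.
  have := secondCountableTopology_unitSpace X
  have := locallyCompactSpace_unitSpace X
  have := t2Space_unitOrbits _proper hr
  have := secondCountableTopology_unitOrbits hr
  have := locallyCompactSpace_unitOrbits hr
  have := isUSCCStarBundle_orbitFibre (α := α) _principal _proper hl hr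
  exact ⟨existsUnique_factorsThrough, fun π x y γ τ h => h.isIrreducibleRep_translate γ,
    equivalence_orbitRel,
    fun π x τ h => h.isIrreducibleRep_induced _principal _proper hl,
    exists_homeomorph _principal _proper hl hr⟩
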